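/- **Setting.** For integers $1\le k\le p$ let $\mathcal X_{p,k}=\{x\in\{0,1\}^p:\|x\|_0=k\}$, and let $G_{p,k}$ be the Johnson graph on $\mathcal X_{p,k}$ (two vectors are adjacent iff their supports meet in exactly $k-1$ elements); it is $\Delta$-regular with $\Delta=k(p-k)$. Let $v^*$ be uniform on $\mathcal X_{p,k}$, let $X\in\mathbb R^{n\times p}$ have i.i.d. $N(0,1)$ entries, let $W\sim N(0,\sigma^2 I_n)$ with $\sigma>0$, all independent, and let $Y=Xv^*+W$ and $H(v)=-\|Y-Xv\|_2^2$ for $v\in\mathcal X_{p,k}$. For $\beta>0$ the Metropolis chain at inverse temperature $\beta$ proposes in each step a uniformly random neighbour $y$ of the current state $x$ in $G_{p,k}$ and moves to it with probability $\min\{1,\pi_\beta(y)/\pi_\beta(x)\}$, where $\pi_\beta(v)\propto e^{\beta H(v)}$; otherwise it stays at $x$. Randomized greedy is the case $\beta=\infty$: the proposal is accepted iff $H(y)\ge H(x)$. We say that such a chain *outputs $v^*$ after $T$ steps with probability at least $q$* if, from every initial state, at every time $t\ge T$ it is at $v^*$ with probability at least $q$ (in particular it visits $v^*$ within $\lceil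 T\rceil$ steps with probability at least $q$). **Theorem 4.2.** There are absolute constants $c,C_0,K_1,K_2,K_3>0$ such that the following holds for every $C\ge C_0$. Assume $k\le p/3$, $$\sigma^2\le c\min\Big\{\frac{\log p}{\log\log p},\,k\Big\},\qquad n\ge C\,k\log(p/k).$$ Then with probability tending to $1$ as $k\to\infty$ over $(v^*,X,W)$ (for every $\varepsilon>0$ there is $k_0=k_0(C,\varepsilon)$ such that for all $k\ge k_0$ and all $p,n,\sigma$ as above the probability of failure is at most $\varepsilon$), all of the following hold simultaneously: 1. for every real $\beta\ge K_1\log(kp)/n$, the Metropolis chain outputs $v^*$ after $K_2\,k^3p\left(\log(pe/k)+\beta n\right)$ steps with probability at least $3/4$; 2. for every real $\beta>8/C$, the Metropolis chain outputs $v^*$ after $K_3\,k^2p$ steps with probability at least $3/4$; 3. randomized greedy ($\beta=\infty$) outputs $v^*$ after $K_3\,k^2p$ steps with probability at least $3/4$. -/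

import Mathlib

open MeasureTheory ProbabilityTheory
open scoped NNReal ENNReal Matrix

/-! ### The Metropolis chain of a Hamiltonian on a finite graph -/

section Chain

variable {V : Type*} [Fintype V] [DecidableEq V]

/-- The Gibbs distribution `π_β(x) ∝ exp (β * H x)` on a finite state space. -/
noncomputable def gibbs (H : V → ℝ) (β : ℝ) (x : V) : ℝ :=
  Real.exp (β * H x) / ∑ z, Real.exp (β * H z)

/-- Metropolis acceptance probability `min {1, π_β(y) / π_β(x)}` of a proposed move `x → y`. -/
noncomputable def metropolisAccept (H : V → ℝ) (β : ℝ) (x y : V) : ℝ :=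
  min 1 (gibbs H β y / gibbs H β x)

open Classical in
/-- Acceptance probability at `β = ∞` (randomized greedy), the limit of `metropolisAccept H β x y`
as `β → ∞`: a proposed move is accepted if and only if it does not decrease `H`. -/
noncomputable def greedyAccept (H : V → ℝ) (x y : V) : ℝ :=
  if H x ≤ H y then 1 else 0

/-- One-step transition probability from `x` to `y` of the chain on the graph `G` that, with `Δ` the
maximum degree, stays put with probability `1 - deg x / Δ`, and otherwise proposes a uniformly
random neighbour `y` of `x` and moves there with probability `a x y` (else stays put).
A given neighbour is thus proposed with probability `(deg x / Δ) * (1 / deg x) = 1 / Δ`. -/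
noncomputable def chainMatrix (G : SimpleGraph V) [DecidableRel G.Adj] (a : V → V → ℝ) :
    Matrix V V ℝ :=
  Matrix.of fun x y =>
    if x = y then 1 - ∑ z ∈ G.neighborFinset x, (1 / (G.maxDegree : ℝ)) * a x z
    else if G.Adj x y then (1 / (G.maxDegree : ℝ)) * a x y
    else 0

/-- The probability that the chain with transition matrix `P` started at `x` is at `y` after `t`
steps. -/
def probAt (P : Matrix V V ℝ) (x : V) (t : ℕ) (y : V) : ℝ := (P ^ t) x y

end Chain

/-! ### Sparse linear regression -/

/-- The parameter space of binary vectors in `{0,1}^p` with exactly `k` ones, each identified with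
its support, a `k`-element subset of the `p` coordinates. -/
abbrev SparseVec (p k : ℕ) : Type := {S : Finset (Fin p) // S.card = k}

/-- The binary vector with support `v`. -/
def SparseVec.toVec {p k : ℕ} (v : SparseVec p k) : Fin p → ℝ :=
  fun j => if j ∈ v.1 then 1 else 0

/-- The Johnson graph: two `k`-subsets are adjacent iff they meet in `k - 1` elements. -/
def johnsonGraph (p k : ℕ) : SimpleGraph (SparseVec p k) where
  Adj x y := (x.1 ∩ y.1).card + 1 = k
  symm := ⟨fun x y h => by rw [Finset.inter_comm]; exact h⟩
  loopless := ⟨fun x h => by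
    have hx := x.2
    rw [Finset.inter_self] at h
    omega⟩

instance (p k : ℕ) : DecidableRel (johnsonGraph p k).Adj :=
  fun x y => inferInstanceAs (Decidable ((x.1 ∩ y.1).card + 1 = k))

/-- The randomness of the model: the signal `v*`, the design matrix `X` and the noise `W`. -/
abbrev SRSample (p k n : ℕ) : Type :=
  SparseVec p k × (Fin n → Fin p → ℝ) × (Fin n → ℝ)

/-- The joint law of `(v*, X, W)`: they are independent, `v*` is uniform over the binary
`k`-sparse vectors, `X` has i.i.d. `N(0,1)` entries and `W` has i.i.d. `N(0,σ²)` entries. -/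
noncomputable def srLaw (p k n : ℕ) (σ : ℝ≥0) : Measure (SRSample p k n) :=
  (uniformOn (Set.univ : Set (SparseVec p k))).prod
    ((Measure.pi fun _ : Fin n => Measure.pi fun _ : Fin p => gaussianReal 0 1).prod
      (Measure.pi fun _ : Fin n => gaussianReal 0 (σ ^ 2)))

/-- The signal `v*`. -/
def SRSample.signal {p k n : ℕ} (ω : SRSample p k n) : SparseVec p k := ω.1

/-- The design matrix `X`. -/
def SRSample.design {p k n : ℕ} (ω : SRSample p k n) : Matrix (Fin n) (Fin p) ℝ :=
  Matrix.of ω.2.1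

/-- The observations `Y = X v* + W`. -/
def SRSample.obs {p k n : ℕ} (ω : SRSample p k n) : Fin n → ℝ :=
  ω.design *ᵥ ω.signal.toVec + ω.2.2

/-- The Hamiltonian `H(v) = -‖Y - X v‖₂²`. -/
def SRSample.hamiltonian {p k n : ℕ} (ω : SRSample p k n) (v : SparseVec p k) : ℝ :=
  -∑ i, (ω.obs i - (ω.design *ᵥ v.toVec) i) ^ 2

/-- The Metropolis chain on the Johnson graph at inverse temperature `β`. -/
noncomputable def SRSample.metropolis {p k n : ℕ} (ω : SRSample p k n) (β : ℝ) :
    Matrix (SparseVec p k) (SparseVec p k) ℝ :=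
  chainMatrix (johnsonGraph p k) (metropolisAccept ω.hamiltonian β)

/-- The randomized greedy algorithm on the Johnson graph (`β = ∞`). -/
noncomputable def SRSample.greedy {p k n : ℕ} (ω : SRSample p k n) :
    Matrix (SparseVec p k) (SparseVec p k) ℝ :=
  chainMatrix (johnsonGraph p k) (greedyAccept ω.hamiltonian)

/-- Started from any state `x`, at every time `t ≥ T` the chain with transition matrix `P` is at
`v` with probability at least `q`. In particular it visits `v` within `⌈T⌉` steps with
probability at least `q`. -/
def OutputsAfter {V : Type*} [Fintype V] [DecidableEq V] (P : Matrix V V ℝ) (v : V)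
    (T q : ℝ) : Prop :=
  ∀ (x : V) (t : ℕ), T ≤ (t : ℝ) → q ≤ probAt P x t v

/-!
Write `u = v* - v` for a state `v` with `m` errors, so that `‖u‖² = 2m`. The residual of `v` is
`X u + W`, and exchanging a wrong coordinate `j` for a missing one `i` changes `H` by
`2 ⟪X u + W, X_i - X_j⟫ - ‖X_i - X_j‖²`. Averaging over all `m²` such exchanges turns the first term
into `(2 / m) ⟪X u + W, X u⟫ ≈ 4n` and the second into about `2n`. Hence, if `‖X u‖² ≈ 2mn` for all
`v`, `‖X_i - X_j‖² ≈ 2n` for all pairs, and `⟪W, X_i⟫` is a small multiple of `n` for all `i`, then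
every state other than `v*` has a neighbour at which `H` is larger by `g = 3n/2`
(`IsRegularSample.gainAwayFrom`), while the range of `H` below its maximum `H(v*)` is at most `3kn`
(`IsRegularSample.hamiltonian_sub_le`). Chi-squared and Gaussian tail bounds with a union bound over
the at most `exp (2 k log (p / k))` states show that this event fails with probability at most `6/p`
(`prod_not_isRegularSample_le_div`).

The rest is deterministic and concerns a chain on a graph of maximum degree `Δ ≤ kp`, where each
state other than `v*` has a neighbour of gain at least `g`. Such a neighbour serves as a parent, and
if `Δ exp (-β g)` is small the children of a state have little Gibbs weight compared with it.
Therefore `v*` carries almost all of the stationary weight, and by reversibility the chain started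
at `v*` is at `v*` with high probability at all times (`metropolis_stay`). It remains to
reach `v*`.

* For the greedy algorithm `H` never decreases and increases by `g` with probability at least `1/Δ`
  in each step, so `O(Δ · 3kn / g) = O(k²p)` steps suffice (`greedy_outputsAfter`).
* For `β n ≥ K₁ log (kp)`, comparing each state with its parent gives a Poincaré inequality for
  functions vanishing at `v*` (`poincare_of_parent`). The survival probability then decays at rate
  `1/(8Δ)` in `L²`, and the initial Gibbs weight enters through its logarithm
  (`metropolis_outputsAfter_of_log_card`).
* For `β > 8/C` one has `β n ≥ 8 k log (p / k)`, so `exp (-β g / 3)` beats the number of states. By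
  reversibility `H` is then very unlikely to have dropped by `g / 3` at any given time; hence in
  each phase of `4Δ` steps `H` gains `g / 3` with high probability (`metropolis_phase`), and `O(k)`
  phases suffice (`metropolis_outputsAfter_of_drift`).
-/

/-! ### Finite reversible chains -/

section FiniteChain

variable {V : Type*} [Fintype V] [DecidableEq V] {P : Matrix V V ℝ}

lemma pow_nonneg_apply (hP : P ∈ Matrix.rowStochastic ℝ V) (t : ℕ) (x y : V) :
    0 ≤ (P ^ t) x y :=
  Matrix.nonneg_of_mem_rowStochastic (pow_mem hP t)

lemma pow_sum_row (hP : P ∈ Matrix.rowStochastic ℝ V) (t : ℕ) (x : V) :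
    ∑ y, (P ^ t) x y = 1 :=
  Matrix.sum_row_of_mem_rowStochastic (pow_mem hP t) x

lemma sum_ne_eq_one_sub (hP : P ∈ Matrix.rowStochastic ℝ V) (t : ℕ) (x v : V) :
    ∑ y ∈ Finset.univ.erase v, (P ^ t) x y = 1 - (P ^ t) x v := by
  rw [← pow_sum_row hP t x, ← Finset.add_sum_erase _ _ (Finset.mem_univ v)]
  ring

lemma reversible_pow {w : V → ℝ} (hrev : ∀ x y, w x * P x y = w y * P y x) (t : ℕ) (x y : V) :
    w x * (P ^ t) x y = w y * (P ^ t) y x := by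
  induction t generalizing x y with
  | zero =>
    by_cases h : x = y
    · subst h; rfl
    · simp [h, Ne.symm h]
  | succ t ih =>
    rw [pow_succ, Matrix.mul_apply, ← pow_succ, pow_succ', Matrix.mul_apply, Finset.mul_sum,
      Finset.mul_sum]
    refine Finset.sum_congr rfl fun z _ => ?_
    calc w x * ((P ^ t) x z * P z y) = (w x * (P ^ t) x z) * P z y := by ring
      _ = (w z * P z y) * (P ^ t) z x := by rw [ih]; ring
      _ = w y * (P y z * (P ^ t) z x) := by rw [hrev]; ring

/-- Reversibility bounds every `t`-step transition probability by the ratio of the stationary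
weights, uniformly in `t`. -/
lemma pow_apply_le_weight_div {w : V → ℝ} (hP : P ∈ Matrix.rowStochastic ℝ V) (hw : ∀ x, 0 < w x)
    (hrev : ∀ x y, w x * P x y = w y * P y x) (t : ℕ) (x y : V) :
    (P ^ t) x y ≤ w y / w x := by
  rw [le_div_iff₀ (hw x), mul_comm, reversible_pow hrev]
  exact mul_le_of_le_one_right (hw y).le (Matrix.le_one_of_mem_rowStochastic (pow_mem hP t))

lemma one_sub_le_pow_apply_self {w : V → ℝ} (hP : P ∈ Matrix.rowStochastic ℝ V)
    (hw : ∀ x, 0 < w x) (hrev : ∀ x y, w x * P x y = w y * P y x) {v : V} {η : ℝ}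
    (hη : ∑ y ∈ Finset.univ.erase v, w y ≤ η * w v) (t : ℕ) :
    1 - η ≤ (P ^ t) v v := by
  have h1 : ∑ y ∈ Finset.univ.erase v, (P ^ t) v y ≤ η := by
    calc _ ≤ ∑ y ∈ Finset.univ.erase v, w y / w v :=
          Finset.sum_le_sum fun y _ => pow_apply_le_weight_div hP hw hrev t v y
      _ ≤ η := by rw [← Finset.sum_div, div_le_iff₀ (hw v)]; exact hη
  rw [sum_ne_eq_one_sub hP] at h1
  linarith

/-- If the chain is likely to be at `v` at some time `j`, and likely to be at `v` at all times when
started there, then it is likely to be at `v` at all times `t ≥ j`. -/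
lemma mul_le_pow_apply (hP : P ∈ Matrix.rowStochastic ℝ V) {v x : V} {a b : ℝ} (hb : 0 ≤ b)
    (hstay : ∀ t, b ≤ (P ^ t) v v) {j t : ℕ} (hjt : j ≤ t) (hj : a ≤ (P ^ j) x v) :
    a * b ≤ (P ^ t) x v := by
  obtain ⟨s, rfl⟩ := Nat.exists_eq_add_of_le hjt
  rw [pow_add, Matrix.mul_apply]
  calc a * b ≤ (P ^ j) x v * (P ^ s) v v :=
        mul_le_mul hj (hstay s) hb (pow_nonneg_apply hP j x v)
    _ ≤ _ := Finset.single_le_sum (f := fun z => (P ^ j) x z * (P ^ s) z v)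
        (fun z _ => mul_nonneg (pow_nonneg_apply hP j x z) (pow_nonneg_apply hP s z v))
        (Finset.mem_univ v)

omit [DecidableEq V] in
lemma mulVec_mono (hP : ∀ x y, 0 ≤ P x y) {f g : V → ℝ} (hfg : ∀ x, f x ≤ g x) (x : V) :
    (P *ᵥ f) x ≤ (P *ᵥ g) x :=
  Finset.sum_le_sum fun y _ => mul_le_mul_of_nonneg_left (hfg y) (hP x y)

/-- Foster's criterion: if the nonnegative function `g` decreases in mean by at least `a` in each
step away from `v`, up to an error `b`, then the chain is rarely away from `v`. -/
lemma sum_one_sub_pow_apply_le (hP : P ∈ Matrix.rowStochastic ℝ V) {v : V} {g : V → ℝ}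
    (hg : ∀ x, 0 ≤ g x) {a b : ℝ}
    (hdrift : ∀ x, (P *ᵥ g) x ≤ g x - (if x = v then 0 else a) + b) (J : ℕ) (x : V) :
    a * ∑ j ∈ Finset.range J, (1 - (P ^ j) x v) ≤ g x + J * b := by
  have key : ∀ J : ℕ, (P ^ J *ᵥ g) x + a * ∑ j ∈ Finset.range J, (1 - (P ^ j) x v)
      ≤ g x + J * b := by
    intro J
    induction J with
    | zero => simp
    | succ J ih =>
      have h1 : (P ^ (J + 1) *ᵥ g) x ≤ (P ^ J *ᵥ g) x - a * (1 - (P ^ J) x v) + b := by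
        rw [pow_succ, ← Matrix.mulVec_mulVec]
        refine (mulVec_mono (pow_nonneg_apply hP J) hdrift x).trans (le_of_eq ?_)
        rw [← sum_ne_eq_one_sub hP J x v, Finset.mul_sum]
        have e1 : ∀ y, (P ^ J) x y * (g y - (if y = v then 0 else a) + b)
            = (P ^ J) x y * g y - a * (if y = v then 0 else (P ^ J) x y) + (P ^ J) x y * b := by
          intro y; split_ifs <;> ring
        simp only [Matrix.mulVec, dotProduct, e1, Finset.sum_add_distrib, Finset.sum_sub_distrib]
        rw [← Finset.sum_mul, pow_sum_row hP, one_mul, ← Finset.mul_sum, ← Finset.mul_sum]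
        congr 3
        rw [← Finset.add_sum_erase _ _ (Finset.mem_univ v), if_pos rfl, zero_add]
        exact Finset.sum_congr rfl fun y hy => if_neg (Finset.ne_of_mem_erase hy)
      rw [Finset.sum_range_succ]
      push_cast
      linarith
  have h0 : 0 ≤ (P ^ J *ᵥ g) x :=
    Matrix.nonneg_mulVec_of_mem_rowStochastic (pow_mem hP J) hg x
  linarith [key J]

lemma exists_pow_apply_ge (hP : P ∈ Matrix.rowStochastic ℝ V) {v : V} {g : V → ℝ}
    (hg : ∀ x, 0 ≤ g x) {a b : ℝ} (ha : 0 < a)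
    (hdrift : ∀ x, (P *ᵥ g) x ≤ g x - (if x = v then 0 else a) + b) {J : ℕ} (hJ : 0 < J) (x : V)
    {ε : ℝ} (hε : g x + J * b ≤ a * (J * ε)) :
    ∃ j < J, 1 - ε ≤ (P ^ j) x v := by
  by_contra! h
  have h1 := sum_one_sub_pow_apply_le hP hg hdrift J x
  have h2 : J * ε < ∑ j ∈ Finset.range J, (1 - (P ^ j) x v) := by
    calc (J : ℝ) * ε = ∑ j ∈ Finset.range J, ε := by simp
      _ < _ := by
        apply Finset.sum_lt_sum_of_nonempty (Finset.nonempty_range_iff.2 hJ.ne')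
        intro j hj
        linarith [h j (Finset.mem_range.1 hj)]
  linarith [mul_lt_mul_of_pos_left h2 ha]

/-- The chain killed on entering `U`: the transition matrix restricted to the complement of `U`. -/
def killed (P : Matrix V V ℝ) (U : Finset V) : Matrix V V ℝ :=
  Matrix.of fun x y => if x ∈ U ∨ y ∈ U then 0 else P x y

/-- The probability that the chain started at `x` avoids `U` up to and including time `t`. -/
def avoid (P : Matrix V V ℝ) (U : Finset V) (t : ℕ) : V → ℝ :=
  killed P U ^ t *ᵥ fun x => if x ∈ U then 0 else 1

omit [Fintype V] in
lemma killed_nonneg (hP : ∀ x y, 0 ≤ P x y) (U : Finset V) (x y : V) : 0 ≤ killed P U x y := by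
  simp only [killed, Matrix.of_apply]; split_ifs
  exacts [le_rfl, hP x y]

omit [Fintype V] in
lemma killed_le (hP : ∀ x y, 0 ≤ P x y) (U : Finset V) (x y : V) : killed P U x y ≤ P x y := by
  simp only [killed, Matrix.of_apply]; split_ifs
  exacts [hP x y, le_rfl]

lemma killed_pow_nonneg (hP : ∀ x y, 0 ≤ P x y) (U : Finset V) (t : ℕ) (x y : V) :
    0 ≤ (killed P U ^ t) x y := by
  induction t generalizing x y with
  | zero => by_cases h : x = y <;> simp [h]
  | succ t ih =>
    rw [pow_succ, Matrix.mul_apply]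
    exact Finset.sum_nonneg fun z _ => mul_nonneg (ih x z) (killed_nonneg hP U z y)

lemma killed_pow_le (hP : P ∈ Matrix.rowStochastic ℝ V) (U : Finset V) (t : ℕ) (x y : V) :
    (killed P U ^ t) x y ≤ (P ^ t) x y := by
  induction t generalizing x y with
  | zero => simp
  | succ t ih =>
    rw [pow_succ, Matrix.mul_apply, pow_succ, Matrix.mul_apply]
    exact Finset.sum_le_sum fun z _ => mul_le_mul (ih x z) (killed_le hP.1 U z y)
      (killed_nonneg hP.1 U z y) (pow_nonneg_apply hP t x z)

lemma avoid_zero (U : Finset V) (x : V) : avoid P U 0 x = if x ∈ U then 0 else 1 := by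
  simp [avoid]

lemma avoid_succ (U : Finset V) (t : ℕ) : avoid P U (t + 1) = killed P U *ᵥ avoid P U t := by
  rw [avoid, avoid, pow_succ', Matrix.mulVec_mulVec]

lemma avoid_nonneg (hP : ∀ x y, 0 ≤ P x y) (U : Finset V) (t : ℕ) (x : V) :
    0 ≤ avoid P U t x := by
  refine Finset.sum_nonneg fun y _ => mul_nonneg (killed_pow_nonneg hP U t x y) ?_
  dsimp only; split_ifs <;> norm_num

lemma killed_mulVec_of_mem {U : Finset V} {x : V} (hx : x ∈ U) (f : V → ℝ) :
    (killed P U *ᵥ f) x = 0 := by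
  simp [Matrix.mulVec, dotProduct, killed, hx]

lemma avoid_of_mem {U : Finset V} {x : V} (hx : x ∈ U) (t : ℕ) : avoid P U t x = 0 := by
  cases t with
  | zero => simp [avoid_zero, hx]
  | succ t => rw [avoid_succ, killed_mulVec_of_mem hx]

lemma avoid_succ_le (hP : P ∈ Matrix.rowStochastic ℝ V) (U : Finset V) (t : ℕ) (x : V) :
    avoid P U (t + 1) x ≤ avoid P U t x := by
  induction t generalizing x with
  | zero =>
    by_cases hx : x ∈ U
    · simp [avoid_of_mem hx]
    · rw [avoid_succ, avoid_zero, if_neg hx, ← Matrix.sum_row_of_mem_rowStochastic hP x]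
      refine Finset.sum_le_sum fun y _ => ?_
      refine (mul_le_of_le_one_right (killed_nonneg hP.1 U x y) ?_).trans (killed_le hP.1 U x y)
      rw [avoid_zero]; split_ifs <;> norm_num
  | succ t ih =>
    rw [avoid_succ U (t + 1)]
    nth_rw 2 [avoid_succ U t]
    exact mulVec_mono (killed_nonneg hP.1 U) ih x

/-- Decomposition at the entrance to `U`: if `φ` stays at most `η` in mean after the chain has
entered `U`, then its mean at time `t` exceeds `η` by at most the probability of avoiding `U`. -/
lemma pow_mulVec_le_add_avoid (hP : P ∈ Matrix.rowStochastic ℝ V) (U : Finset V) {φ : V → ℝ}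
    (hφ : ∀ x, φ x ≤ 1) {η : ℝ} (hη : 0 ≤ η) (hU : ∀ x ∈ U, ∀ t, (P ^ t *ᵥ φ) x ≤ η)
    (t : ℕ) (x : V) : (P ^ t *ᵥ φ) x ≤ η + avoid P U t x := by
  induction t generalizing x with
  | zero =>
    by_cases hx : x ∈ U
    · simpa [avoid_zero, hx] using hU x hx 0
    · simp only [pow_zero, Matrix.one_mulVec, avoid_zero, if_neg hx]
      linarith [hφ x]
  | succ t ih =>
    by_cases hx : x ∈ U
    · simpa [avoid_of_mem hx] using hU x hx (t + 1)
    · rw [pow_succ', ← Matrix.mulVec_mulVec, avoid_succ]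
      have : ∀ z, P x z * (P ^ t *ᵥ φ) z ≤ P x z * η + killed P U x z * avoid P U t z := by
        intro z
        by_cases hz : z ∈ U
        · rw [avoid_of_mem hz, mul_zero, add_zero]
          exact mul_le_mul_of_nonneg_left (hU z hz t) (hP.1 x z)
        · have : killed P U x z = P x z := by simp [killed, hx, hz]
          rw [this, ← mul_add]
          exact mul_le_mul_of_nonneg_left (ih z) (hP.1 x z)
      calc (P *ᵥ (P ^ t *ᵥ φ)) x
          ≤ ∑ z, (P x z * η + killed P U x z * avoid P U t z) :=
            Finset.sum_le_sum fun z _ => this z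
        _ = η + (killed P U *ᵥ avoid P U t) x := by
            rw [Finset.sum_add_distrib, ← Finset.sum_mul,
              Matrix.sum_row_of_mem_rowStochastic hP, one_mul]
            rfl

/-- If `U` is entered with probability at least `r` in each step from outside `U ∪ B`, and the chain
is in `B` with probability at most `η` at any time, then `U` is avoided for `t` steps with
probability at most `(1 - r) ^ t + η`. -/
lemma avoid_le_pow_add (hP : P ∈ Matrix.rowStochastic ℝ V) (U B : Finset V) {r η : ℝ}
    (hr0 : 0 ≤ r) (hr1 : r ≤ 1) (hη : 0 ≤ η) {x : V} (hB : ∀ t, ∑ y ∈ B, (P ^ t) x y ≤ η)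
    (hU : ∀ y, y ∉ U → y ∉ B → r ≤ ∑ z ∈ U, P y z) (t : ℕ) :
    avoid P U t x ≤ (1 - r) ^ t + η := by
  set χ : V → ℝ := fun x => if x ∈ U then 0 else 1 with hχ
  have h1 : ∀ y, (killed P U *ᵥ χ) y ≤ (1 - r) * χ y + r * (if y ∈ B then 1 else 0) := by
    intro y
    by_cases hy : y ∈ U
    · rw [killed_mulVec_of_mem hy]
      simp only [hχ, if_pos hy]
      split_ifs <;> simp [hr0]
    · have e : (killed P U *ᵥ χ) y = 1 - ∑ z ∈ U, P y z := by
        rw [← Matrix.sum_row_of_mem_rowStochastic hP y, eq_sub_iff_add_eq,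
          ← Finset.sum_filter_add_sum_filter_not Finset.univ (· ∈ U) (P y), add_comm]
        congr 1
        · exact Finset.sum_congr (by ext; simp) fun _ _ => rfl
        · rw [Finset.sum_filter]
          refine Finset.sum_congr rfl fun z _ => ?_
          by_cases hz : z ∈ U <;> simp [killed, hχ, hz, hy]
      rw [e]
      simp only [hχ, if_neg hy]
      by_cases hyB : y ∈ B
      · have : 0 ≤ ∑ z ∈ U, P y z := Finset.sum_nonneg fun z _ => hP.1 y z
        simp [hyB, this]
      · have := hU y hy hyB
        simp [hyB]; linarith
  induction t with
  | zero => rw [avoid_zero, pow_zero]; split_ifs <;> linarith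
  | succ t ih =>
    have h2 : avoid P U (t + 1) x ≤ (1 - r) * avoid P U t x + r * η := by
      rw [avoid, pow_succ, ← Matrix.mulVec_mulVec]
      calc _ ≤ (killed P U ^ t *ᵥ fun y => (1 - r) * χ y + r * (if y ∈ B then 1 else 0)) x :=
            mulVec_mono (killed_pow_nonneg hP.1 U t) h1 x
        _ = (1 - r) * avoid P U t x + r * ∑ y ∈ B, (killed P U ^ t) x y := by
            simp only [avoid, Matrix.mulVec, dotProduct, mul_add, Finset.sum_add_distrib]
            congr 1
            · rw [Finset.mul_sum]
              exact Finset.sum_congr rfl fun y _ => by simp only [hχ]; ring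
            · rw [Finset.mul_sum, ← Finset.sum_filter_add_sum_filter_not Finset.univ (· ∈ B),
                Finset.sum_eq_zero (s := Finset.univ.filter (· ∉ B)), add_zero]
              · refine Finset.sum_congr (by ext; simp) fun y hy => ?_
                rw [if_pos hy]; ring
              · intro y hy
                rw [if_neg (Finset.mem_filter.1 hy).2]; ring
        _ ≤ (1 - r) * avoid P U t x + r * η := by
            gcongr
            exact (Finset.sum_le_sum fun y _ => killed_pow_le hP U t x y).trans (hB t)
    calc avoid P U (t + 1) x ≤ (1 - r) * ((1 - r) ^ t + η) + r * η :=
          h2.trans (by gcongr)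
      _ = (1 - r) ^ (t + 1) + η := by ring

end FiniteChain

/-! ### Hitting times from a Poincaré inequality along a parent map -/

section Poincare

variable {V : Type*} [Fintype V] [DecidableEq V] {P : Matrix V V ℝ} {w : V → ℝ} {v : V}

/-- Summation along the fibres of a parent map. -/
lemma sum_erase_mul_parent_le {par : V → V} {δ : ℝ}
    (hpar : ∀ z, ∑ x ∈ (Finset.univ.erase v).filter (fun x => par x = z), w x ≤ δ * w z)
    {f : V → ℝ} (hf : ∀ x, 0 ≤ f x) :
    ∑ x ∈ Finset.univ.erase v, w x * f (par x) ≤ δ * ∑ z, w z * f z := by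
  rw [← Finset.sum_fiberwise (Finset.univ.erase v) par, Finset.mul_sum]
  refine Finset.sum_le_sum fun z _ => ?_
  calc _ = (∑ x ∈ (Finset.univ.erase v).filter (fun x => par x = z), w x) * f z := by
        rw [Finset.sum_mul]
        exact Finset.sum_congr rfl fun x hx => by rw [(Finset.mem_filter.1 hx).2]
    _ ≤ δ * w z * f z := mul_le_mul_of_nonneg_right (hpar z) (hf z)
    _ = δ * (w z * f z) := by ring

lemma sum_erase_le_of_parent {par : V → V} {δ : ℝ} (hδ : δ ≤ 1 / 2) (hw : ∀ x, 0 < w x)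
    (hpar : ∀ z, ∑ x ∈ (Finset.univ.erase v).filter (fun x => par x = z), w x ≤ δ * w z) :
    ∑ y ∈ Finset.univ.erase v, w y ≤ 2 * δ * w v := by
  have h := sum_erase_mul_parent_le hpar (f := fun _ => 1) fun _ => zero_le_one
  simp only [mul_one] at h
  rw [← Finset.add_sum_erase _ _ (Finset.mem_univ v)] at h
  have h0 : 0 ≤ ∑ y ∈ Finset.univ.erase v, w y := Finset.sum_nonneg fun y _ => (hw y).le
  nlinarith

/-- The Dirichlet form identity `⟨f, P f⟩ = ⟨f, f⟩ - E(f, f)`. -/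
lemma two_mul_inner_mulVec_eq (hP : P ∈ Matrix.rowStochastic ℝ V)
    (hrev : ∀ x y, w x * P x y = w y * P y x) (f : V → ℝ) :
    2 * ∑ x, w x * f x * (P *ᵥ f) x
      = 2 * ∑ x, w x * f x ^ 2 - ∑ x, ∑ y, w x * P x y * (f x - f y) ^ 2 := by
  have h1 : ∑ x, ∑ y, w x * P x y * f x ^ 2 = ∑ x, w x * f x ^ 2 := by
    refine Finset.sum_congr rfl fun x _ => ?_
    rw [← Finset.sum_mul, ← Finset.mul_sum, Matrix.sum_row_of_mem_rowStochastic hP, mul_one]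
  have h2 : ∑ x, ∑ y, w x * P x y * f y ^ 2 = ∑ x, w x * f x ^ 2 := by
    rw [Finset.sum_comm, ← h1]
    exact Finset.sum_congr rfl fun x _ => Finset.sum_congr rfl fun y _ => by rw [hrev]
  have h3 : ∑ x, w x * f x * (P *ᵥ f) x = ∑ x, ∑ y, w x * P x y * (f x * f y) := by
    refine Finset.sum_congr rfl fun x _ => ?_
    rw [Matrix.mulVec, dotProduct, Finset.mul_sum]
    exact Finset.sum_congr rfl fun y _ => by ring
  have h4 : ∑ x, ∑ y, w x * P x y * (f x - f y) ^ 2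
      = ∑ x, ∑ y, w x * P x y * f x ^ 2 + ∑ x, ∑ y, w x * P x y * f y ^ 2
        - 2 * ∑ x, ∑ y, w x * P x y * (f x * f y) := by
    simp only [Finset.mul_sum, ← Finset.sum_add_distrib, ← Finset.sum_sub_distrib]
    exact Finset.sum_congr rfl fun x _ => Finset.sum_congr rfl fun y _ => by ring
  rw [h3, h4, h1, h2]; ring

/-- A Poincaré inequality for functions vanishing at `v`. When every state other than `v` has a
parent that is entered with probability at least `r`, and the states with a common parent weigh
together at most a quarter of it, splitting `f x = (f x - f (par x)) + f (par x)` bounds the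
variance by the Dirichlet form; no factor for the depth of the tree is lost. -/
lemma poincare_of_parent (hP : P ∈ Matrix.rowStochastic ℝ V) (hw : ∀ x, 0 < w x)
    {par : V → V} {r : ℝ} (hr : 0 < r) (hPpar : ∀ x, x ≠ v → r ≤ P x (par x))
    (hpar : ∀ z, ∑ x ∈ (Finset.univ.erase v).filter (fun x => par x = z), w x ≤ 1 / 4 * w z)
    {f : V → ℝ} (hf : f v = 0) :
    r * ∑ x, w x * f x ^ 2 ≤ 4 * ∑ x, ∑ y, w x * P x y * (f x - f y) ^ 2 := by
  have h1 : ∑ x, w x * f x ^ 2 = ∑ x ∈ Finset.univ.erase v, w x * f x ^ 2 := by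
    rw [← Finset.add_sum_erase _ _ (Finset.mem_univ v)]; simp [hf]
  have h2 := sum_erase_mul_parent_le hpar (f := fun x => f x ^ 2) fun x => sq_nonneg _
  have h3 : r * ∑ x ∈ Finset.univ.erase v, w x * (f x - f (par x)) ^ 2
      ≤ ∑ x, ∑ y, w x * P x y * (f x - f y) ^ 2 := by
    have hnn : ∀ x y, 0 ≤ w x * P x y * (f x - f y) ^ 2 := fun x y =>
      mul_nonneg (mul_nonneg (hw x).le (hP.1 x y)) (sq_nonneg _)
    rw [Finset.mul_sum]
    calc _ ≤ ∑ x ∈ Finset.univ.erase v, ∑ y, w x * P x y * (f x - f y) ^ 2 := by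
          refine Finset.sum_le_sum fun x hx => ?_
          refine le_trans ?_ (Finset.single_le_sum (fun y _ => hnn x y) (Finset.mem_univ (par x)))
          have := mul_le_mul_of_nonneg_right (hPpar x (Finset.ne_of_mem_erase hx))
            (mul_nonneg (hw x).le (sq_nonneg (f x - f (par x))))
          linarith
      _ ≤ _ := Finset.sum_le_sum_of_subset_of_nonneg (Finset.subset_univ _)
          fun x _ _ => Finset.sum_nonneg fun y _ => hnn x y
  have h4 : ∑ x ∈ Finset.univ.erase v, w x * f x ^ 2
      ≤ 2 * ∑ x ∈ Finset.univ.erase v, w x * (f x - f (par x)) ^ 2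
        + 2 * ∑ x ∈ Finset.univ.erase v, w x * f (par x) ^ 2 := by
    rw [Finset.mul_sum, Finset.mul_sum, ← Finset.sum_add_distrib]
    refine Finset.sum_le_sum fun x _ => ?_
    nlinarith [mul_nonneg (hw x).le (sq_nonneg (f x - 2 * f (par x)))]
  rw [← h1] at h4
  nlinarith

lemma killed_mulVec_le (hP : P ∈ Matrix.rowStochastic ℝ V) (U : Finset V) {f : V → ℝ}
    (hf : ∀ x, 0 ≤ f x) (x : V) : (killed P U *ᵥ f) x ≤ (P *ᵥ f) x :=
  Finset.sum_le_sum fun y _ => mul_le_mul_of_nonneg_right (killed_le hP.1 U x y) (hf y)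

/-- Exponential decay of the `L²` norm of the survival probability `f_t = avoid P {v} t`. Since
`f_{t+1} ≤ f_t` pointwise, `‖f_{t+1}‖² ≤ ⟨f_t, f_{t+1}⟩ ≤ ⟨f_t, P f_t⟩`, so the Poincaré inequality
suffices and negative eigenvalues of `P` do not matter. -/
lemma sum_sq_avoid_le (hP : P ∈ Matrix.rowStochastic ℝ V) (hw : ∀ x, 0 < w x)
    (hrev : ∀ x y, w x * P x y = w y * P y x)
    {par : V → V} {r : ℝ} (hr : 0 < r) (hr1 : r ≤ 1) (hPpar : ∀ x, x ≠ v → r ≤ P x (par x))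
    (hpar : ∀ z, ∑ x ∈ (Finset.univ.erase v).filter (fun x => par x = z), w x ≤ 1 / 4 * w z)
    (t : ℕ) :
    ∑ x, w x * avoid P {v} t x ^ 2 ≤ (1 - r / 8) ^ t * ∑ x, w x := by
  induction t with
  | zero =>
    rw [pow_zero, one_mul]
    refine Finset.sum_le_sum fun x _ => mul_le_of_le_one_right (hw x).le ?_
    rw [avoid_zero]; split_ifs <;> norm_num
  | succ t ih =>
    have h0 : ∀ s x, 0 ≤ avoid P {v} s x := fun s x => avoid_nonneg hP.1 _ s x
    have h1 : ∑ x, w x * avoid P {v} (t + 1) x ^ 2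
        ≤ ∑ x, w x * avoid P {v} t x * (P *ᵥ avoid P {v} t) x := by
      refine Finset.sum_le_sum fun x _ => ?_
      rw [sq, mul_assoc]
      refine mul_le_mul_of_nonneg_left ?_ (hw x).le
      refine mul_le_mul (avoid_succ_le hP _ t x) ?_ (h0 _ x) (h0 _ x)
      rw [avoid_succ]
      exact killed_mulVec_le hP _ (h0 t) x
    have h2 := two_mul_inner_mulVec_eq hP hrev (avoid P {v} t)
    have h3 := poincare_of_parent hP hw hr hPpar hpar
      (f := avoid P {v} t) (avoid_of_mem (Finset.mem_singleton_self v) t)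
    have h4 : (1 - r / 8) * ∑ x, w x * avoid P {v} t x ^ 2 ≤ (1 - r / 8) ^ (t + 1) * ∑ x, w x := by
      rw [pow_succ', mul_assoc]
      exact mul_le_mul_of_nonneg_left ih (by linarith)
    linarith

lemma sq_avoid_le (hP : P ∈ Matrix.rowStochastic ℝ V) (hw : ∀ x, 0 < w x)
    (hrev : ∀ x y, w x * P x y = w y * P y x)
    {par : V → V} {r : ℝ} (hr : 0 < r) (hr1 : r ≤ 1) (hPpar : ∀ x, x ≠ v → r ≤ P x (par x))
    (hpar : ∀ z, ∑ x ∈ (Finset.univ.erase v).filter (fun x => par x = z), w x ≤ 1 / 4 * w z)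
    (t : ℕ) (x : V) :
    avoid P {v} t x ^ 2 ≤ Real.exp (-(r / 8 * t)) * ((∑ y, w y) / w x) := by
  have h1 := sum_sq_avoid_le hP hw hrev hr hr1 hPpar hpar t
  have h2 : w x * avoid P {v} t x ^ 2 ≤ ∑ y, w y * avoid P {v} t y ^ 2 :=
    Finset.single_le_sum (f := fun y => w y * avoid P {v} t y ^ 2)
      (fun y _ => mul_nonneg (hw y).le (sq_nonneg _)) (Finset.mem_univ x)
  have h3 : (1 - r / 8) ^ t ≤ Real.exp (-(r / 8 * t)) := by
    calc (1 - r / 8) ^ t ≤ Real.exp (-(r / 8)) ^ t := by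
          apply pow_le_pow_left₀ (by linarith)
          linarith [Real.add_one_le_exp (-(r / 8))]
      _ = _ := by rw [← Real.exp_nat_mul]; congr 1; ring
  have h4 : 0 ≤ ∑ y, w y := Finset.sum_nonneg fun y _ => (hw y).le
  rw [← mul_div_assoc, le_div_iff₀ (hw x)]
  nlinarith [mul_le_mul_of_nonneg_right h3 h4]

end Poincare

/-! ### The chain on a graph -/

section Graph

variable {V : Type*} [Fintype V] [DecidableEq V] {G : SimpleGraph V} [DecidableRel G.Adj]
  {a : V → V → ℝ}

lemma chainMatrix_of_adj {x y : V} (h : G.Adj x y) :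
    chainMatrix G a x y = 1 / (G.maxDegree : ℝ) * a x y := by
  simp [chainMatrix, h.ne, h]

lemma chainMatrix_of_not_adj {x y : V} (hne : x ≠ y) (h : ¬ G.Adj x y) :
    chainMatrix G a x y = 0 := by
  simp [chainMatrix, hne, h]

lemma chainMatrix_self (x : V) :
    chainMatrix G a x x = 1 - ∑ z ∈ G.neighborFinset x, 1 / (G.maxDegree : ℝ) * a x z := by
  simp [chainMatrix]

lemma chainMatrix_mulVec (f : V → ℝ) (x : V) :
    (chainMatrix G a *ᵥ f) x
      = f x + ∑ z ∈ G.neighborFinset x, 1 / (G.maxDegree : ℝ) * a x z * (f z - f x) := by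
  have hx : x ∉ G.neighborFinset x := by simp
  have h0 : ∀ z ∈ Finset.univ, z ∉ insert x (G.neighborFinset x) →
      chainMatrix G a x z * f z = 0 := by
    intro z _ hz
    rw [Finset.mem_insert, SimpleGraph.mem_neighborFinset, not_or] at hz
    rw [chainMatrix_of_not_adj (Ne.symm hz.1) hz.2, zero_mul]
  have h1 : ∀ z ∈ G.neighborFinset x, chainMatrix G a x z * f z
      = 1 / (G.maxDegree : ℝ) * a x z * f z := by
    intro z hz
    rw [chainMatrix_of_adj ((G.mem_neighborFinset x z).1 hz)]
  rw [Matrix.mulVec, dotProduct, ← Finset.sum_subset (Finset.subset_univ _) h0,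
    Finset.sum_insert hx, chainMatrix_self, Finset.sum_congr rfl h1]
  simp only [mul_sub, Finset.sum_sub_distrib, ← Finset.sum_mul]
  ring

lemma chainMatrix_mem_rowStochastic (ha0 : ∀ x y, 0 ≤ a x y) (ha1 : ∀ x y, a x y ≤ 1) :
    chainMatrix G a ∈ Matrix.rowStochastic ℝ V := by
  refine ⟨fun x y => ?_, funext fun x => ?_⟩
  · by_cases hxy : x = y
    · subst hxy
      rw [chainMatrix_self, sub_nonneg]
      calc _ ≤ ∑ z ∈ G.neighborFinset x, 1 / (G.maxDegree : ℝ) :=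
            Finset.sum_le_sum fun z _ => mul_le_of_le_one_right (by positivity) (ha1 x z)
        _ = (G.degree x : ℝ) / G.maxDegree := by
            rw [Finset.sum_const, nsmul_eq_mul, SimpleGraph.card_neighborFinset_eq_degree]; ring
        _ ≤ 1 := div_le_one_of_le₀ (by exact_mod_cast G.degree_le_maxDegree x) (by positivity)
    · by_cases h : G.Adj x y
      · rw [chainMatrix_of_adj h]
        exact mul_nonneg (by positivity) (ha0 x y)
      · rw [chainMatrix_of_not_adj hxy h]
  · rw [chainMatrix_mulVec]; simp

omit [Fintype V] [DecidableEq V] in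
lemma greedyAccept_nonneg (H : V → ℝ) (x y : V) : 0 ≤ greedyAccept H x y := by
  unfold greedyAccept; split_ifs <;> norm_num

omit [Fintype V] [DecidableEq V] in
lemma greedyAccept_le_one (H : V → ℝ) (x y : V) : greedyAccept H x y ≤ 1 := by
  unfold greedyAccept; split_ifs <;> norm_num

omit [DecidableEq V] in
lemma metropolisAccept_eq [Nonempty V] (H : V → ℝ) (β : ℝ) (x y : V) :
    metropolisAccept H β x y = min 1 (Real.exp (β * H y) / Real.exp (β * H x)) := by
  have : 0 < ∑ z, Real.exp (β * H z) :=
    Finset.sum_pos (fun z _ => Real.exp_pos _) Finset.univ_nonempty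
  unfold metropolisAccept gibbs
  rw [div_div_div_cancel_right₀ this.ne']

omit [DecidableEq V] in
lemma metropolisAccept_nonneg (H : V → ℝ) (β : ℝ) (x y : V) : 0 ≤ metropolisAccept H β x y := by
  unfold metropolisAccept gibbs; positivity

omit [DecidableEq V] in
lemma metropolisAccept_le_one (H : V → ℝ) (β : ℝ) (x y : V) : metropolisAccept H β x y ≤ 1 :=
  min_le_left _ _

omit [DecidableEq V] in
lemma metropolisAccept_of_le {H : V → ℝ} {β : ℝ} (hβ : 0 ≤ β) {x y : V} (h : H x ≤ H y) :
    metropolisAccept H β x y = 1 := by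
  have : Nonempty V := ⟨x⟩
  rw [metropolisAccept_eq, min_eq_left]
  rw [one_le_div (Real.exp_pos _)]
  exact Real.exp_le_exp.2 (mul_le_mul_of_nonneg_left h hβ)

/-- Detailed balance of the Metropolis chain, with the unnormalized Gibbs weights. -/
lemma metropolis_reversible (H : V → ℝ) (β : ℝ) (x y : V) :
    Real.exp (β * H x) * chainMatrix G (metropolisAccept H β) x y
      = Real.exp (β * H y) * chainMatrix G (metropolisAccept H β) y x := by
  have : Nonempty V := ⟨x⟩
  by_cases hxy : x = y
  · rw [hxy]
  by_cases h : G.Adj x y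
  · rw [chainMatrix_of_adj h, chainMatrix_of_adj h.symm, metropolisAccept_eq, metropolisAccept_eq]
    have hx := Real.exp_pos (β * H x)
    have hy := Real.exp_pos (β * H y)
    have e1 : Real.exp (β * H x) * min 1 (Real.exp (β * H y) / Real.exp (β * H x))
        = min (Real.exp (β * H x)) (Real.exp (β * H y)) := by
      rw [mul_min_of_nonneg _ _ hx.le, mul_one, mul_div_cancel₀ _ hx.ne']
    have e2 : Real.exp (β * H y) * min 1 (Real.exp (β * H x) / Real.exp (β * H y))
        = min (Real.exp (β * H y)) (Real.exp (β * H x)) := by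
      rw [mul_min_of_nonneg _ _ hy.le, mul_one, mul_div_cancel₀ _ hy.ne']
    calc _ = 1 / (G.maxDegree : ℝ) *
          (Real.exp (β * H x) * min 1 (Real.exp (β * H y) / Real.exp (β * H x))) := by ring
      _ = 1 / (G.maxDegree : ℝ) *
          (Real.exp (β * H y) * min 1 (Real.exp (β * H x) / Real.exp (β * H y))) := by
          rw [e1, e2, min_comm]
      _ = _ := by ring
  · rw [chainMatrix_of_not_adj hxy h, chainMatrix_of_not_adj (Ne.symm hxy) fun h' => h h'.symm]
    simp

end Graph

/-! ### Chains on a landscape without spurious local maxima -/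

section Landscape

variable {V : Type*} [Fintype V] [DecidableEq V] {G : SimpleGraph V} [DecidableRel G.Adj]
  {H : V → ℝ} {v : V} {g R : ℝ}

/-- Every state other than `v` has a neighbour at which `H` is larger by at least `g`. -/
def GainAwayFrom (G : SimpleGraph V) (H : V → ℝ) (v : V) (g : ℝ) : Prop :=
  ∀ x, x ≠ v → ∃ y, G.Adj x y ∧ H x + g ≤ H y

omit [DecidableEq V] [DecidableRel G.Adj] in
lemma GainAwayFrom.add_le (hgain : GainAwayFrom G H v g) (hg : 0 < g) {x : V} (hx : x ≠ v) :
    H x + g ≤ H v := by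
  obtain ⟨m, -, hm⟩ := Finset.exists_max_image Finset.univ H ⟨v, Finset.mem_univ v⟩
  have hmv : m = v := by
    by_contra h
    obtain ⟨y, -, hy⟩ := hgain m h
    linarith [hm y (Finset.mem_univ y)]
  obtain ⟨y, -, hy⟩ := hgain x hx
  rw [← hmv]
  linarith [hm y (Finset.mem_univ y)]

omit [DecidableEq V] [DecidableRel G.Adj] in
lemma GainAwayFrom.le (hgain : GainAwayFrom G H v g) (hg : 0 < g) (x : V) : H x ≤ H v := by
  by_cases hx : x = v
  · rw [hx]
  · linarith [hgain.add_le hg hx]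

lemma outputsAfter_of_exists {P : Matrix V V ℝ} (hP : P ∈ Matrix.rowStochastic ℝ V)
    {T q a b : ℝ} (hb : 0 ≤ b) (hstay : ∀ t, b ≤ (P ^ t) v v) (hq : q ≤ a * b)
    (hreach : ∀ x, ∃ j : ℕ, (j : ℝ) ≤ T ∧ a ≤ (P ^ j) x v) : OutputsAfter P v T q := by
  intro x t ht
  obtain ⟨j, hj, hja⟩ := hreach x
  exact hq.trans (mul_le_pow_apply hP hb hstay (by exact_mod_cast hj.trans ht) hja)

lemma greedy_outputsAfter (hgain : GainAwayFrom G H v g) (hg : 0 < g)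
    (hR : ∀ x, H v - H x ≤ R) (hΔ : 0 < G.maxDegree) {T : ℝ}
    (hT : 4 * (R / g) * G.maxDegree + 1 ≤ T) :
    OutputsAfter (chainMatrix G (greedyAccept H)) v T (3 / 4) := by
  set P := chainMatrix G (greedyAccept H) with hPdef
  have hP : P ∈ Matrix.rowStochastic ℝ V :=
    chainMatrix_mem_rowStochastic (greedyAccept_nonneg H) (greedyAccept_le_one H)
  have hΔ' : (0 : ℝ) < G.maxDegree := by exact_mod_cast hΔ
  have hR0 : 0 ≤ R := by simpa using hR v
  have hv0 : ∀ z ∈ G.neighborFinset v, greedyAccept H v z = 0 := by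
    intro z hz
    have hzv : z ≠ v := ((G.mem_neighborFinset v z).1 hz).ne'
    exact if_neg (by linarith [hgain.add_le hg hzv])
  -- The maximum is absorbing.
  have hstay : ∀ t, (1 : ℝ) ≤ (P ^ t) v v := by
    have h1 : P v v = 1 := by
      rw [hPdef, chainMatrix_self, Finset.sum_eq_zero, sub_zero]
      intro z hz; rw [hv0 z hz, mul_zero]
    intro t
    induction t with
    | zero => simp
    | succ t ih =>
      rw [pow_succ, Matrix.mul_apply]
      refine le_trans ?_ (Finset.single_le_sum (f := fun z => (P ^ t) v z * P z v)
        (fun z _ => mul_nonneg (pow_nonneg_apply hP t v z) (hP.1 z v)) (Finset.mem_univ v))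
      rw [h1, mul_one]; exact ih
  have hdrift : ∀ x, (P *ᵥ fun y => H v - H y) x
      ≤ (H v - H x) - (if x = v then 0 else g / G.maxDegree) + 0 := by
    intro x
    rw [hPdef, chainMatrix_mulVec]
    by_cases hx : x = v
    · subst hx
      rw [Finset.sum_eq_zero]
      · simp
      · intro z hz; rw [hv0 z hz]; ring
    · rw [if_neg hx]
      obtain ⟨y, hxy, hy⟩ := hgain x hx
      have h1 : ∀ z, 0 ≤ -(1 / (G.maxDegree : ℝ) * greedyAccept H x z
          * ((H v - H z) - (H v - H x))) := by
        intro z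
        unfold greedyAccept
        split_ifs with h
        · have : 0 ≤ 1 / (G.maxDegree : ℝ) * (H z - H x) :=
            mul_nonneg (by positivity) (by linarith)
          linarith
        · simp
      have h2 := Finset.single_le_sum (fun z _ => h1 z) ((G.mem_neighborFinset x y).2 hxy)
      rw [Finset.sum_neg_distrib] at h2
      have h3 : greedyAccept H x y = 1 := if_pos (by linarith)
      rw [h3] at h2
      have h4 : 1 / (G.maxDegree : ℝ) * g ≤ 1 / (G.maxDegree : ℝ) * (H y - H x) :=
        mul_le_mul_of_nonneg_left (by linarith) (by positivity)
      have h5 : g / (G.maxDegree : ℝ) = 1 / (G.maxDegree : ℝ) * g := by ring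
      rw [h5]
      linarith
  have hT1 : 1 ≤ T := by
    have : 0 ≤ 4 * (R / g) * G.maxDegree := by positivity
    linarith
  have hT0 : (0 : ℝ) ≤ T := by linarith
  have hJ : 0 < ⌊T⌋₊ := Nat.floor_pos.2 hT1
  have hJT : 4 * (R / g) * G.maxDegree ≤ (⌊T⌋₊ : ℝ) := by linarith [Nat.lt_floor_add_one T]
  refine outputsAfter_of_exists hP zero_le_one hstay (a := 1 - 1 / 4) (by norm_num) fun x => ?_
  obtain ⟨j, hj, hja⟩ := exists_pow_apply_ge hP (g := fun y => H v - H y)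
    (fun y => by linarith [hgain.le hg y]) (by positivity) hdrift hJ x (ε := 1 / 4) (by
      have e : R = g / G.maxDegree * (4 * (R / g) * G.maxDegree * (1 / 4)) := by
        field_simp
      have h6 : g / G.maxDegree * (4 * (R / g) * G.maxDegree * (1 / 4))
          ≤ g / G.maxDegree * (⌊T⌋₊ * (1 / 4)) := by gcongr
      rw [mul_zero, add_zero]
      linarith [hR x])
  exact ⟨j, (Nat.cast_le.2 hj.le).trans (Nat.floor_le hT0), hja⟩

/-- The neighbour of larger `H` provided by `GainAwayFrom`, as a parent map. By the gain, the
children of a state weigh little in total. -/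
lemma GainAwayFrom.exists_parent (hgain : GainAwayFrom G H v g) {β : ℝ} (hβ : 0 ≤ β)
    (hg : 0 < g) :
    ∃ par : V → V,
      (∀ x, x ≠ v → 1 / (G.maxDegree : ℝ) ≤ chainMatrix G (metropolisAccept H β) x (par x)) ∧
      ∀ z, ∑ x ∈ (Finset.univ.erase v).filter (fun x => par x = z), Real.exp (β * H x)
        ≤ G.maxDegree * Real.exp (-(β * g)) * Real.exp (β * H z) := by
  have : ∀ x, ∃ y, x ≠ v → G.Adj x y ∧ H x + g ≤ H y := by
    intro x
    by_cases hx : x = v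
    · exact ⟨x, fun h => absurd hx h⟩
    · obtain ⟨y, hy⟩ := hgain x hx
      exact ⟨y, fun _ => hy⟩
  choose par hpar using this
  refine ⟨par, fun x hx => ?_, fun z => ?_⟩
  · rw [chainMatrix_of_adj (hpar x hx).1,
      metropolisAccept_of_le hβ (by linarith [(hpar x hx).2]), mul_one]
  · calc _ ≤ ∑ x ∈ (Finset.univ.erase v).filter (fun x => par x = z),
          Real.exp (-(β * g)) * Real.exp (β * H z) := by
          refine Finset.sum_le_sum fun x hx => ?_
          rw [Finset.mem_filter, Finset.mem_erase] at hx
          rw [← Real.exp_add, Real.exp_le_exp, ← hx.2]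
          nlinarith [(hpar x hx.1.1).2]
      _ ≤ ∑ x ∈ G.neighborFinset z, Real.exp (-(β * g)) * Real.exp (β * H z) := by
          refine Finset.sum_le_sum_of_subset_of_nonneg (fun x hx => ?_)
            fun _ _ _ => by positivity
          rw [Finset.mem_filter, Finset.mem_erase] at hx
          rw [SimpleGraph.mem_neighborFinset, ← hx.2]
          exact (hpar x hx.1.1).1.symm
      _ ≤ _ := by
          rw [Finset.sum_const, nsmul_eq_mul, SimpleGraph.card_neighborFinset_eq_degree, mul_assoc]
          gcongr
          exact G.degree_le_maxDegree z

lemma metropolis_mem_rowStochastic (H : V → ℝ) (β : ℝ) :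
    chainMatrix G (metropolisAccept H β) ∈ Matrix.rowStochastic ℝ V :=
  chainMatrix_mem_rowStochastic (metropolisAccept_nonneg H β) (metropolisAccept_le_one H β)

/-- Started at the maximum, the chain is there with high probability at all times. -/
lemma metropolis_stay (hgain : GainAwayFrom G H v g) (hg : 0 < g) {β : ℝ} (hβ : 0 ≤ β) {δ : ℝ}
    (hδ : G.maxDegree * Real.exp (-(β * g)) ≤ δ) (hδ' : δ ≤ 1 / 2) (t : ℕ) :
    1 - 2 * δ ≤ (chainMatrix G (metropolisAccept H β) ^ t) v v := by
  obtain ⟨par, -, hpar⟩ := hgain.exists_parent hβ hg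
  refine one_sub_le_pow_apply_self (metropolis_mem_rowStochastic H β)
    (w := fun x => Real.exp (β * H x)) (fun x => Real.exp_pos _) (metropolis_reversible H β)
    (sum_erase_le_of_parent hδ' (fun x => Real.exp_pos _) (par := par) fun z => ?_) t
  exact (hpar z).trans (mul_le_mul_of_nonneg_right hδ (Real.exp_pos _).le)

/-- At low temperature the time to reach the maximum is the relaxation time, of order the degree,
times the logarithm of the inverse Gibbs weight of the initial state. -/
lemma metropolis_outputsAfter_of_log_card (hgain : GainAwayFrom G H v g) (hg : 0 < g)
    (hR : ∀ x, H v - H x ≤ R) (hΔ : 0 < G.maxDegree) {β : ℝ} (hβ : 0 ≤ β)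
    (hδ : G.maxDegree * Real.exp (-(β * g)) ≤ 1 / 100) {T : ℝ}
    (hT : 8 * G.maxDegree * (Real.log (Fintype.card V) + β * R + 5) ≤ T) :
    OutputsAfter (chainMatrix G (metropolisAccept H β)) v T (3 / 4) := by
  intro x t ht
  have hP := metropolis_mem_rowStochastic (G := G) H β
  set P := chainMatrix G (metropolisAccept H β) with hPdef
  have hΔ' : (1 : ℝ) ≤ G.maxDegree := by exact_mod_cast hΔ
  obtain ⟨par, hpar1, hpar2⟩ := hgain.exists_parent hβ hg
  have hw : ∀ x, 0 < Real.exp (β * H x) := fun x => Real.exp_pos _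
  have hav := sq_avoid_le hP (w := fun x => Real.exp (β * H x)) hw (metropolis_reversible H β)
    (r := 1 / (G.maxDegree : ℝ)) (by positivity) (div_le_one_of_le₀ hΔ' (by positivity)) hpar1
    (fun z => (hpar2 z).trans (mul_le_mul_of_nonneg_right (by linarith) (hw z).le)) t x
  have hcard : (0 : ℝ) < Fintype.card V := by exact_mod_cast Fintype.card_pos_iff.2 ⟨x⟩
  have hZ : (∑ y, Real.exp (β * H y)) / Real.exp (β * H x)
      ≤ Real.exp (Real.log (Fintype.card V) + β * R) := by
    rw [Real.exp_add, Real.exp_log hcard, div_le_iff₀ (hw x), mul_assoc, ← Real.exp_add]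
    calc _ ≤ ∑ y : V, Real.exp (β * R + β * H x) := by
          refine Finset.sum_le_sum fun y _ => Real.exp_le_exp.2 ?_
          rw [← mul_add]
          exact mul_le_mul_of_nonneg_left (by linarith [hgain.le hg y, hR x]) hβ
      _ = _ := by simp
  have hsq : avoid P {v} t x ^ 2 ≤ 1 / 100 := by
    calc _ ≤ Real.exp (-(1 / (G.maxDegree : ℝ) / 8 * t))
          * Real.exp (Real.log (Fintype.card V) + β * R) :=
          hav.trans (mul_le_mul_of_nonneg_left hZ (Real.exp_pos _).le)
      _ ≤ Real.exp (-5) := by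
          rw [← Real.exp_add, Real.exp_le_exp]
          have h1 : Real.log (Fintype.card V) + β * R + 5 ≤ 1 / (G.maxDegree : ℝ) / 8 * t := by
            rw [div_div, one_div_mul_eq_div, le_div_iff₀ (by positivity)]
            linarith
          linarith
      _ ≤ 1 / 100 := by
          rw [Real.exp_neg, inv_eq_one_div]
          apply one_div_le_one_div_of_le (by norm_num)
          have h1 : (2.7 : ℝ) ≤ Real.exp 1 := by linarith [Real.exp_one_gt_d9]
          calc (100 : ℝ) ≤ 2.7 ^ 5 := by norm_num
            _ ≤ Real.exp 1 ^ 5 := by gcongr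
            _ = Real.exp 5 := by rw [← Real.exp_nat_mul]; norm_num
  have hav' : avoid P {v} t x ≤ 1 / 10 := by
    nlinarith [avoid_nonneg hP.1 {v} t x]
  have hφ : ∀ s y, (P ^ s *ᵥ fun z => if z = v then (0 : ℝ) else 1) y = 1 - (P ^ s) y v := by
    intro s y
    rw [← sum_ne_eq_one_sub hP, Matrix.mulVec, dotProduct,
      ← Finset.add_sum_erase _ _ (Finset.mem_univ v), if_pos rfl, mul_zero, zero_add]
    exact Finset.sum_congr rfl fun z hz => by rw [if_neg (Finset.ne_of_mem_erase hz), mul_one]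
  have h := pow_mulVec_le_add_avoid hP {v} (φ := fun z => if z = v then (0 : ℝ) else 1)
    (fun z => by split_ifs <;> norm_num) (η := 2 * (1 / 100)) (by norm_num)
    (fun y hy s => by
      rw [Finset.mem_singleton] at hy
      rw [hφ, hy]
      linarith [metropolis_stay hgain hg hβ hδ (by norm_num) s]) t x
  rw [hφ] at h
  unfold probAt
  linarith

/-- By reversibility, moving to a state of smaller `H` costs an exponential factor at any time; the
bound is summed over all states. -/
lemma sum_pow_apply_drop_le {P : Matrix V V ℝ}
    (hP : P ∈ Matrix.rowStochastic ℝ V) {β : ℝ}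
    (hβ : 0 ≤ β) (hrev : ∀ x y, Real.exp (β * H x) * P x y = Real.exp (β * H y) * P y x)
    {s η : ℝ} (hη : Fintype.card V * Real.exp (-(β * s)) ≤ η) (x : V) (t : ℕ) :
    ∑ y ∈ Finset.univ.filter (fun y => H y < H x - s), (P ^ t) x y ≤ η := by
  calc _ ≤ ∑ y ∈ Finset.univ.filter (fun y => H y < H x - s), Real.exp (-(β * s)) := by
        refine Finset.sum_le_sum fun y hy => ?_
        refine (pow_apply_le_weight_div hP (w := fun x => Real.exp (β * H x))
          (fun x => Real.exp_pos _) hrev t x y).trans ?_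
        rw [← Real.exp_sub, Real.exp_le_exp]
        nlinarith [(Finset.mem_filter.1 hy).2]
    _ ≤ ∑ y : V, Real.exp (-(β * s)) :=
        Finset.sum_le_sum_of_subset_of_nonneg (Finset.subset_univ _)
          fun _ _ _ => (Real.exp_pos _).le
    _ ≤ η := by simpa using hη

/-- Starting from `x ≠ v`, after `4 Δ` steps the value of `H` has increased by `g / 3` with
probability at least `24 / 25`. By reversibility `H` has not dropped by `g / 3` at any given time,
up to a small probability; as long as this is so, a move that brings `H` above `H x + 2 * g / 3` is
made with probability at least `1 / Δ` in each step; and from there `H` does not drop by `g / 3`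
either. -/
lemma metropolis_phase (hgain : GainAwayFrom G H v g) (hg : 0 < g) (hΔ : 0 < G.maxDegree)
    {β : ℝ} (hβ : 0 ≤ β) {η : ℝ} (hη : Fintype.card V * Real.exp (-(β * (g / 3))) ≤ η)
    (hη' : η ≤ 1 / 100) {x : V} (hx : x ≠ v) :
    (chainMatrix G (metropolisAccept H β) ^ (4 * G.maxDegree)
      *ᵥ fun y => if H y < H x + g / 3 then (1 : ℝ) else 0) x ≤ 1 / 25 := by
  have hP := metropolis_mem_rowStochastic (G := G) H β
  have hrev := metropolis_reversible (G := G) H β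
  set P := chainMatrix G (metropolisAccept H β) with hPdef
  have hη0 : 0 ≤ η := le_trans (by positivity) hη
  have hdrop := sum_pow_apply_drop_le hP hβ hrev hη
  have hΔ' : (1 : ℝ) ≤ G.maxDegree := by exact_mod_cast hΔ
  set φ : V → ℝ := fun y => if H y < H x + g / 3 then (1 : ℝ) else 0 with hφ
  set U : Finset V := Finset.univ.filter fun y => H x + 2 * (g / 3) ≤ H y with hU
  set B : Finset V := Finset.univ.filter fun y => H y < H x - g / 3 with hB
  have h1 := pow_mulVec_le_add_avoid hP U (φ := φ)
    (fun y => by simp only [hφ]; split_ifs <;> norm_num) hη0 (fun u hu t => by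
      refine le_trans ?_ (hdrop u t)
      rw [Matrix.mulVec, dotProduct, Finset.sum_filter]
      refine Finset.sum_le_sum fun y _ => ?_
      have hu' := (Finset.mem_filter.1 hu).2
      have h0 := pow_nonneg_apply hP t u y
      simp only [hφ]
      split_ifs with ha hb hb
      · simp
      · linarith
      · simpa using h0
      · simp) (4 * G.maxDegree) x
  have hvU : v ∈ U := Finset.mem_filter.2 ⟨Finset.mem_univ _, by
    linarith [hgain.add_le hg hx]⟩
  have h2 := avoid_le_pow_add hP U B (r := 1 / (G.maxDegree : ℝ)) (η := η) (by positivity)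
    (div_le_one_of_le₀ hΔ' (by positivity)) hη0 (hdrop x) (fun y hyU hyB => by
      have hyv : y ≠ v := fun h => hyU (h ▸ hvU)
      obtain ⟨z, hyz, hz⟩ := hgain y hyv
      have hyB' : H x - g / 3 ≤ H y := by
        by_contra hc
        exact hyB (Finset.mem_filter.2 ⟨Finset.mem_univ _, by linarith⟩)
      have hzU : z ∈ U := Finset.mem_filter.2 ⟨Finset.mem_univ _, by linarith⟩
      refine le_trans ?_ (Finset.single_le_sum (fun z _ => hP.1 y z) hzU)
      rw [hPdef, chainMatrix_of_adj hyz, metropolisAccept_of_le hβ (by linarith), mul_one])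
    (4 * G.maxDegree)
  have h3 : (1 - 1 / (G.maxDegree : ℝ)) ^ (4 * G.maxDegree) ≤ 1 / 50 := by
    calc (1 - 1 / (G.maxDegree : ℝ)) ^ (4 * G.maxDegree)
        ≤ Real.exp (-(1 / (G.maxDegree : ℝ))) ^ (4 * G.maxDegree) := by
          refine pow_le_pow_left₀ ?_ ?_ _
          · rw [sub_nonneg]; exact div_le_one_of_le₀ hΔ' (by positivity)
          · linarith [Real.add_one_le_exp (-(1 / (G.maxDegree : ℝ)))]
      _ = Real.exp (-4) := by
          rw [← Real.exp_nat_mul]; congr 1; push_cast; field_simp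
      _ ≤ 1 / 50 := by
          rw [Real.exp_neg, inv_eq_one_div]
          apply one_div_le_one_div_of_le (by norm_num)
          have h1 : (2.7 : ℝ) ≤ Real.exp 1 := by linarith [Real.exp_one_gt_d9]
          calc (50 : ℝ) ≤ 2.7 ^ 4 := by norm_num
            _ ≤ Real.exp 1 ^ 4 := by gcongr
            _ = Real.exp 4 := by rw [← Real.exp_nat_mul]; norm_num
  linarith

/-- When `β * g` exceeds a multiple of the logarithm of the number of states, the maximum is reached
in time of order the degree times the number `R / g` of gains that fit into the range of `H`. -/
lemma metropolis_outputsAfter_of_drift (hgain : GainAwayFrom G H v g) (hg : 0 < g)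
    (hR : ∀ x, H v - H x ≤ R) (hR0 : 0 < R) (hΔ : 0 < G.maxDegree) {β : ℝ} (hβ : 0 ≤ β)
    {η : ℝ} (hη : Fintype.card V * Real.exp (-(β * (g / 3))) ≤ η)
    (hη' : η ≤ 1 / 100) (hRη : R * η ≤ g / 100)
    {δ : ℝ} (hδ : G.maxDegree * Real.exp (-(β * g)) ≤ δ) (hδ' : δ ≤ 1 / 100)
    (hRδ : R * δ ≤ g / 100) {T : ℝ} (hT : (30 * (R / g) + 1) * (4 * G.maxDegree) ≤ T) :
    OutputsAfter (chainMatrix G (metropolisAccept H β)) v T (3 / 4) := by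
  have hP := metropolis_mem_rowStochastic (G := G) H β
  have hrev := metropolis_reversible (G := G) H β
  have hstay := metropolis_stay hgain hg hβ hδ (by linarith)
  have hphase := fun x (hx : x ≠ v) => metropolis_phase hgain hg hΔ hβ hη hη' hx
  set P := chainMatrix G (metropolisAccept H β) with hPdef
  have hδ0 : 0 ≤ δ := le_trans (by positivity) hδ
  have hdrop := sum_pow_apply_drop_le hP hβ hrev hη
  set l := 4 * G.maxDegree with hl
  have hdrift : ∀ x, (P ^ l *ᵥ fun y => H v - H y) x
      ≤ (H v - H x) - (if x = v then 0 else 4 / 15 * g) + g / 50 := by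
    intro x
    by_cases hx : x = v
    · subst hx
      rw [if_pos rfl, sub_self, sub_zero, zero_add]
      calc (P ^ l *ᵥ fun y => H x - H y) x ≤ ∑ y ∈ Finset.univ.erase x, (P ^ l) x y * R := by
            rw [Matrix.mulVec, dotProduct, ← Finset.add_sum_erase _ _ (Finset.mem_univ x),
              sub_self, mul_zero, zero_add]
            exact Finset.sum_le_sum fun y _ =>
              mul_le_mul_of_nonneg_left (hR y) (pow_nonneg_apply hP l x y)
        _ = (1 - (P ^ l) x x) * R := by rw [← Finset.sum_mul, sum_ne_eq_one_sub hP]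
        _ ≤ 2 * δ * R := mul_le_mul_of_nonneg_right (by linarith [hstay l]) hR0.le
        _ ≤ g / 50 := by linarith
    · rw [if_neg hx]
      -- The phase gains `g / 3`, or loses at most `g / 3`, or `H` drops by more, but at most by `R`.
      have h1 : ∀ y, (P ^ l) x y * (H v - H y) ≤ (P ^ l) x y * (H v - H x - g / 3)
          + 2 * (g / 3) * ((P ^ l) x y * (if H y < H x + g / 3 then 1 else 0))
          + (if H y < H x - g / 3 then (P ^ l) x y else 0) * R := by
        intro y
        have h0 := pow_nonneg_apply hP l x y
        have hRy := hR y
        have hx' := hgain.le hg x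
        split_ifs with ha hb hb
        · have := mul_le_mul_of_nonneg_left
            (show H v - H y ≤ (H v - H x - g / 3) + 2 * (g / 3) + R by linarith) h0
          linarith
        · have := mul_le_mul_of_nonneg_left
            (show H v - H y ≤ (H v - H x - g / 3) + 2 * (g / 3) by linarith) h0
          linarith
        · linarith
        · have := mul_le_mul_of_nonneg_left
            (show H v - H y ≤ (H v - H x - g / 3) by linarith) h0
          linarith
      have h2 := Finset.sum_le_sum fun y (_ : y ∈ Finset.univ) => h1 y
      rw [Finset.sum_add_distrib, Finset.sum_add_distrib, ← Finset.sum_mul, pow_sum_row hP,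
        ← Finset.mul_sum, ← Finset.sum_mul, ← Finset.sum_filter] at h2
      have h3 := hphase x hx
      have h4 := mul_le_mul_of_nonneg_right (hdrop x l) hR0.le
      simp only [Matrix.mulVec, dotProduct] at h3 ⊢
      nlinarith
  have hJ : 0 < ⌈30 * (R / g)⌉₊ := Nat.ceil_pos.2 (by positivity)
  refine outputsAfter_of_exists hP (b := 98 / 100) (by norm_num)
    (fun t => le_trans (by linarith) (hstay t)) (a := 1 - 1 / 5) (by norm_num) fun x => ?_
  obtain ⟨j, hj, hja⟩ := exists_pow_apply_ge (pow_mem hP l) (g := fun y => H v - H y)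
    (fun y => by linarith [hgain.le hg y]) (by positivity) hdrift hJ x (ε := 1 / 5) (by
      have h5 : 30 * R ≤ ⌈30 * (R / g)⌉₊ * g := by
        rw [← div_le_iff₀ hg, mul_div_assoc]
        exact Nat.le_ceil _
      linarith [hR x])
  rw [← pow_mul] at hja
  refine ⟨l * j, le_trans ?_ hT, hja⟩
  have h6 : (j : ℝ) ≤ 30 * (R / g) + 1 :=
    (Nat.cast_le.2 hj.le).trans (Nat.ceil_lt_add_one (by positivity)).le
  rw [hl]; push_cast
  rw [mul_comm]
  gcongr

end Landscape

/-! ### The Johnson graph -/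

section Johnson

variable {p k : ℕ}

/-- The `k`-subset obtained from `v` by exchanging `j ∈ v` for `i ∉ v`. -/
def SparseVec.swap (v : SparseVec p k) {i j : Fin p} (hi : i ∉ v.1) (hj : j ∈ v.1) :
    SparseVec p k :=
  ⟨insert i (v.1.erase j), by
    rw [Finset.card_insert_of_notMem (fun h => hi (Finset.mem_of_mem_erase h)),
      Finset.card_erase_of_mem hj, v.2]
    have : 0 < k := by rw [← v.2]; exact Finset.card_pos.2 ⟨j, hj⟩
    omega⟩

lemma SparseVec.adj_swap (v : SparseVec p k) {i j : Fin p} (hi : i ∉ v.1) (hj : j ∈ v.1) :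
    (johnsonGraph p k).Adj v (v.swap hi hj) := by
  have h : v.1 ∩ (v.swap hi hj).1 = v.1.erase j := by
    ext l
    simp only [SparseVec.swap, Finset.mem_inter, Finset.mem_insert, Finset.mem_erase]
    constructor
    · rintro ⟨h1, rfl | h2⟩
      · exact absurd h1 hi
      · exact h2
    · exact fun h => ⟨h.2, Or.inr h⟩
  change (v.1 ∩ (v.swap hi hj).1).card + 1 = k
  rw [h, Finset.card_erase_of_mem hj, v.2]
  have : 0 < k := by rw [← v.2]; exact Finset.card_pos.2 ⟨j, hj⟩
  omega

lemma SparseVec.toVec_swap (v : SparseVec p k) {i j : Fin p} (hi : i ∉ v.1) (hj : j ∈ v.1)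
    (l : Fin p) :
    (v.swap hi hj).toVec l
      = v.toVec l + (if l = i then 1 else 0) - (if l = j then 1 else 0) := by
  have hij : i ≠ j := fun h => hi (h ▸ hj)
  simp only [SparseVec.toVec, SparseVec.swap, Finset.mem_insert, Finset.mem_erase]
  by_cases h1 : l = i
  · subst h1; simp [hi, hij]
  · by_cases h2 : l = j
    · subst h2; simp [hj, h1]
    · simp [h1, h2]

lemma johnsonGraph_maxDegree_le : (johnsonGraph p k).maxDegree ≤ k * p := by
  refine SimpleGraph.maxDegree_le_of_forall_degree_le _ _ fun x => ?_
  rw [← SimpleGraph.card_neighborFinset_eq_degree]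
  have hsub : ((johnsonGraph p k).neighborFinset x).image Subtype.val
      ⊆ (x.1 ×ˢ (Finset.univ : Finset (Fin p))).image fun q => insert q.2 (x.1.erase q.1) := by
    intro y' hy'
    obtain ⟨y, hy, rfl⟩ := Finset.mem_image.1 hy'
    rw [SimpleGraph.mem_neighborFinset] at hy
    change (x.1 ∩ y.1).card + 1 = k at hy
    have h1 : (x.1 \ y.1).card = 1 := by
      have := Finset.card_sdiff_add_card_inter x.1 y.1
      rw [x.2] at this; omega
    have h2 : (y.1 \ x.1).card = 1 := by
      have := Finset.card_sdiff_add_card_inter y.1 x.1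
      rw [y.2, Finset.inter_comm] at this; omega
    obtain ⟨j, hj⟩ := Finset.card_eq_one.1 h1
    obtain ⟨i, hi⟩ := Finset.card_eq_one.1 h2
    have hj' : ∀ l, (l ∈ x.1 ∧ l ∉ y.1) ↔ l = j := fun l => by
      rw [← Finset.mem_sdiff, hj, Finset.mem_singleton]
    have hi' : ∀ l, (l ∈ y.1 ∧ l ∉ x.1) ↔ l = i := fun l => by
      rw [← Finset.mem_sdiff, hi, Finset.mem_singleton]
    refine Finset.mem_image.2 ⟨(j, i), Finset.mem_product.2 ⟨((hj' j).2 rfl).1,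
      Finset.mem_univ _⟩, ?_⟩
    ext l
    simp only [Finset.mem_insert, Finset.mem_erase]
    have a := hj' l
    have b := hi' l
    tauto
  calc ((johnsonGraph p k).neighborFinset x).card
      = (((johnsonGraph p k).neighborFinset x).image Subtype.val).card :=
        (Finset.card_image_of_injective _ Subtype.val_injective).symm
    _ ≤ _ := Finset.card_le_card hsub
    _ ≤ (x.1 ×ˢ (Finset.univ : Finset (Fin p))).card := Finset.card_image_le
    _ = k * p := by rw [Finset.card_product, x.2, Finset.card_univ, Fintype.card_fin]

lemma SparseVec.sdiff_nonempty {S v : SparseVec p k} (h : v ≠ S) : (S.1 \ v.1).Nonempty := by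
  rw [Finset.nonempty_iff_ne_empty, ne_eq, Finset.sdiff_eq_empty_iff_subset]
  intro hsub
  exact h (Subtype.ext (Finset.eq_of_subset_of_card_le hsub (by rw [v.2, S.2])).symm)

lemma SparseVec.card_sdiff_eq (S v : SparseVec p k) : (v.1 \ S.1).card = (S.1 \ v.1).card := by
  have h1 := Finset.card_sdiff_add_card_inter v.1 S.1
  have h2 := Finset.card_sdiff_add_card_inter S.1 v.1
  rw [Finset.inter_comm, v.2] at h1
  rw [S.2] at h2
  omega

lemma SparseVec.sum_mul_sub_toVec (S v : SparseVec p k) (c : Fin p → ℝ) :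
    ∑ j, c j * (S.toVec j - v.toVec j) = ∑ j ∈ S.1 \ v.1, c j - ∑ j ∈ v.1 \ S.1, c j := by
  rw [← Finset.sum_ite_mem_eq (S.1 \ v.1), ← Finset.sum_ite_mem_eq (v.1 \ S.1),
    ← Finset.sum_sub_distrib]
  refine Finset.sum_congr rfl fun j _ => ?_
  by_cases h1 : j ∈ S.1 <;> by_cases h2 : j ∈ v.1 <;> simp [SparseVec.toVec, h1, h2]

/-- The squared norm of the difference of two sparse vectors is twice the number of errors. -/
lemma SparseVec.sum_sq_sub_toVec (S v : SparseVec p k) :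
    ∑ j, (S.toVec j - v.toVec j) ^ 2 = 2 * ((S.1 \ v.1).card : ℝ) := by
  have h := SparseVec.sum_mul_sub_toVec S v fun j => S.toVec j - v.toVec j
  have h1 : ∑ j ∈ S.1 \ v.1, (S.toVec j - v.toVec j) = (S.1 \ v.1).card := by
    rw [Finset.card_eq_sum_ones, Nat.cast_sum]
    refine Finset.sum_congr rfl fun j hj => ?_
    rw [Finset.mem_sdiff] at hj
    simp [SparseVec.toVec, hj.1, hj.2]
  have h2 : ∑ j ∈ v.1 \ S.1, (S.toVec j - v.toVec j) = -((S.1 \ v.1).card : ℝ) := by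
    rw [← SparseVec.card_sdiff_eq S v, Finset.card_eq_sum_ones, Nat.cast_sum,
      ← Finset.sum_neg_distrib]
    refine Finset.sum_congr rfl fun j hj => ?_
    rw [Finset.mem_sdiff] at hj
    simp [SparseVec.toVec, hj.1, hj.2]
  simp only [sq]
  rw [h, h1, h2]; ring

end Johnson

/-! ### The landscape of the regression Hamiltonian -/

section Regression

variable {p k n : ℕ} {X : Fin n → Fin p → ℝ} {W : Fin n → ℝ} {S : SparseVec p k}

/-- The squared Euclidean norm of `X z`. -/
def sqNormApply (X : Fin n → Fin p → ℝ) (z : Fin p → ℝ) : ℝ := ∑ l, (∑ j, X l j * z j) ^ 2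

/-- The event on which the landscape is benign. The design acts almost isometrically, up to the
factor `√n`, on the differences of sparse vectors from the signal and on the differences of two
coordinate vectors, and the noise is almost orthogonal to its columns. -/
structure IsRegularSample (X : Fin n → Fin p → ℝ) (W : Fin n → ℝ) (S : SparseVec p k) : Prop where
  le_sqNorm : ∀ v : SparseVec p k, v ≠ S →
    (1 - 1 / 24) * (∑ j, (S.toVec j - v.toVec j) ^ 2) * n
      ≤ sqNormApply X fun j => S.toVec j - v.toVec j
  sqNorm_le : ∀ v : SparseVec p k, v ≠ S →
    sqNormApply X (fun j => S.toVec j - v.toVec j)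
      ≤ (1 + 1 / 24) * (∑ j, (S.toVec j - v.toVec j) ^ 2) * n
  sqDist_le : ∀ i j : Fin p, i ≠ j → ∑ l, (X l i - X l j) ^ 2 ≤ (1 + 1 / 24) * 2 * n
  noise_le : ∀ j : Fin p, |∑ l, W l * X l j| ≤ n / 16

lemma hamiltonian_eq (v : SparseVec p k) :
    SRSample.hamiltonian (S, X, W) v
      = -∑ l, (∑ j, X l j * (S.toVec j - v.toVec j) + W l) ^ 2 := by
  unfold SRSample.hamiltonian SRSample.obs SRSample.design SRSample.signal
  congr 1
  refine Finset.sum_congr rfl fun l _ => ?_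
  simp only [Pi.add_apply, Matrix.mulVec, dotProduct, Matrix.of_apply, mul_sub,
    Finset.sum_sub_distrib]
  congr 1
  ring

lemma IsRegularSample.abs_sum_noise_le (h : IsRegularSample X W S) (v : SparseVec p k) :
    |∑ l, W l * ∑ j, X l j * (S.toVec j - v.toVec j)| ≤ (S.1 \ v.1).card * n / 8 := by
  have e : ∑ l, W l * ∑ j, X l j * (S.toVec j - v.toVec j)
      = ∑ j, (∑ l, W l * X l j) * (S.toVec j - v.toVec j) := by
    simp only [Finset.mul_sum, Finset.sum_mul]
    rw [Finset.sum_comm]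
    exact Finset.sum_congr rfl fun j _ => Finset.sum_congr rfl fun l _ => by ring
  rw [e, SparseVec.sum_mul_sub_toVec]
  have hb : ∀ A : Finset (Fin p), |∑ j ∈ A, ∑ l, W l * X l j| ≤ A.card * (n / 16) := by
    intro A
    refine (Finset.abs_sum_le_sum_abs _ _).trans ?_
    rw [← nsmul_eq_mul]
    exact Finset.sum_le_card_nsmul _ _ _ fun j _ => h.noise_le j
  have h1 := hb (S.1 \ v.1)
  have h2 := hb (v.1 \ S.1)
  rw [SparseVec.card_sdiff_eq] at h2
  refine (abs_sub _ _).trans ?_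
  linarith

/-- The change of the Hamiltonian under a swap, in terms of the residual. -/
lemma hamiltonian_swap (v : SparseVec p k) {i j : Fin p} (hi : i ∉ v.1) (hj : j ∈ v.1) :
    SRSample.hamiltonian (S, X, W) (v.swap hi hj) = SRSample.hamiltonian (S, X, W) v
      + (2 * ∑ l, (∑ j, X l j * (S.toVec j - v.toVec j) + W l) * (X l i - X l j)
        - ∑ l, (X l i - X l j) ^ 2) := by
  have e : ∀ l, ∑ m, X l m * (S.toVec m - (v.swap hi hj).toVec m)
      = ∑ m, X l m * (S.toVec m - v.toVec m) - (X l i - X l j) := by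
    intro l
    have : ∀ m, X l m * (S.toVec m - (v.swap hi hj).toVec m)
        = X l m * (S.toVec m - v.toVec m) - (X l m * (if m = i then 1 else 0)
          - X l m * (if m = j then 1 else 0)) := by
      intro m; rw [SparseVec.toVec_swap]; ring
    simp [this, Finset.sum_sub_distrib]
  rw [hamiltonian_eq, hamiltonian_eq, Finset.mul_sum, ← Finset.sum_sub_distrib,
    ← Finset.sum_neg_distrib, ← Finset.sum_neg_distrib, ← Finset.sum_add_distrib]
  refine Finset.sum_congr rfl fun l _ => ?_
  rw [e]; ring

/-- On the regular event some swap of a missing coordinate for a wrong one gains `3 n / 2`, since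
the gain averaged over all such swaps does: summed over the pairs `(i, j)`, the differences
`X_i - X_j` of columns give a multiple of `X (S - v)`. -/
lemma IsRegularSample.exists_swap (h : IsRegularSample X W S) {v : SparseVec p k} (hv : v ≠ S) :
    ∃ y, (johnsonGraph p k).Adj v y ∧
      SRSample.hamiltonian (S, X, W) v + 3 / 2 * n ≤ SRSample.hamiltonian (S, X, W) y := by
  set A := S.1 \ v.1 with hA
  set D := v.1 \ S.1 with hD
  set r : Fin n → ℝ := fun l => ∑ j, X l j * (S.toVec j - v.toVec j) + W l with hr
  have hAne : A.Nonempty := SparseVec.sdiff_nonempty hv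
  have hcard : D.card = A.card := SparseVec.card_sdiff_eq S v
  have hDne : D.Nonempty := by rw [← Finset.card_pos, hcard]; exact Finset.card_pos.2 hAne
  have hm : (0 : ℝ) < A.card := by exact_mod_cast Finset.card_pos.2 hAne
  -- The total gain of all swaps.
  have hsum : ∑ q ∈ A ×ˢ D, ∑ l, r l * (X l q.1 - X l q.2)
      = A.card * ∑ l, r l * ∑ j, X l j * (S.toVec j - v.toVec j) := by
    rw [Finset.sum_comm, Finset.mul_sum]
    refine Finset.sum_congr rfl fun l _ => ?_
    rw [← Finset.mul_sum, SparseVec.sum_mul_sub_toVec, Finset.sum_product]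
    simp only [Finset.sum_sub_distrib, Finset.sum_const, nsmul_eq_mul, hcard]
    rw [← Finset.mul_sum]
    ring
  have hinner : ∑ l, r l * ∑ j, X l j * (S.toVec j - v.toVec j)
      = sqNormApply X (fun j => S.toVec j - v.toVec j)
        + ∑ l, W l * ∑ j, X l j * (S.toVec j - v.toVec j) := by
    rw [sqNormApply, ← Finset.sum_add_distrib]
    exact Finset.sum_congr rfl fun l _ => by simp only [hr]; ring
  have hnorm := h.le_sqNorm v hv
  rw [SparseVec.sum_sq_sub_toVec] at hnorm
  have hnoise := (abs_le.1 (h.abs_sum_noise_le v)).1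
  have hdist : ∑ q ∈ A ×ˢ D, ∑ l, (X l q.1 - X l q.2) ^ 2
      ≤ (A.card : ℝ) ^ 2 * ((1 + 1 / 24) * 2 * n) := by
    calc _ ≤ ∑ q ∈ A ×ˢ D, ((1 + 1 / 24) * 2 * (n : ℝ)) := by
          refine Finset.sum_le_sum fun q hq => h.sqDist_le q.1 q.2 fun hq' => ?_
          rw [Finset.mem_product, hA, hD, Finset.mem_sdiff, Finset.mem_sdiff] at hq
          exact hq.1.2 (hq' ▸ hq.2.1)
      _ = _ := by
          rw [Finset.sum_const, Finset.card_product, hcard, nsmul_eq_mul]; push_cast; ring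
  have htotal : ∑ q ∈ A ×ˢ D, (3 / 2 * (n : ℝ))
      ≤ ∑ q ∈ A ×ˢ D, (2 * ∑ l, r l * (X l q.1 - X l q.2) - ∑ l, (X l q.1 - X l q.2) ^ 2) := by
    rw [Finset.sum_const, Finset.card_product, hcard, nsmul_eq_mul, Finset.sum_sub_distrib,
      ← Finset.mul_sum, hsum, hinner]
    push_cast
    have h1 : (A.card : ℝ) * ((1 - 1 / 24) * (2 * A.card) * n - A.card * n / 8)
        ≤ A.card * (sqNormApply X (fun j => S.toVec j - v.toVec j)
          + ∑ l, W l * ∑ j, X l j * (S.toVec j - v.toVec j)) :=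
      mul_le_mul_of_nonneg_left (by linarith) hm.le
    nlinarith
  obtain ⟨q, hq, hle⟩ := Finset.exists_le_of_sum_le (hAne.product hDne) htotal
  rw [Finset.mem_product, hA, hD, Finset.mem_sdiff, Finset.mem_sdiff] at hq
  exact ⟨v.swap hq.1.2 hq.2.1, v.adj_swap _ _, by rw [hamiltonian_swap]; linarith⟩

lemma IsRegularSample.gainAwayFrom (h : IsRegularSample X W S) :
    GainAwayFrom (johnsonGraph p k) (SRSample.hamiltonian (S, X, W)) S (3 / 2 * n) :=
  fun _ hv => h.exists_swap hv

/-- The range of the Hamiltonian: as its value at the signal is `-‖W‖²`, the difference equals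
`‖X u‖² + 2 ⟪W, X u⟫` with `u = S - v` of squared norm at most `2 k`. -/
lemma IsRegularSample.hamiltonian_sub_le (h : IsRegularSample X W S) (v : SparseVec p k) :
    SRSample.hamiltonian (S, X, W) S - SRSample.hamiltonian (S, X, W) v ≤ 3 * k * n := by
  by_cases hv : v = S
  · rw [hv, sub_self]; positivity
  have e : SRSample.hamiltonian (S, X, W) S - SRSample.hamiltonian (S, X, W) v
      = sqNormApply X (fun j => S.toVec j - v.toVec j)
        + 2 * ∑ l, W l * ∑ j, X l j * (S.toVec j - v.toVec j) := by
    rw [hamiltonian_eq, hamiltonian_eq, sqNormApply, Finset.mul_sum, ← Finset.sum_add_distrib,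
      ← Finset.sum_neg_distrib, ← Finset.sum_neg_distrib, ← Finset.sum_sub_distrib]
    refine Finset.sum_congr rfl fun l _ => ?_
    simp only [sub_self, mul_zero, Finset.sum_const_zero]
    ring
  have hnorm := h.sqNorm_le v hv
  rw [SparseVec.sum_sq_sub_toVec] at hnorm
  have hnoise := (abs_le.1 (h.abs_sum_noise_le v)).2
  have hk : ((S.1 \ v.1).card : ℝ) ≤ k := by
    exact_mod_cast (Finset.card_le_card Finset.sdiff_subset).trans S.2.le
  have h0 : ((S.1 \ v.1).card : ℝ) * n ≤ k * n := by gcongr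
  have h1 : (0 : ℝ) ≤ k * n := by positivity
  rw [e]
  nlinarith

end Regression

/-! ### Gaussian tail bounds -/

section Gaussian

lemma sqrt_inv_one_sub_le_exp {s : ℝ} (hs : |s| ≤ 1 / 4) :
    √(1 / (1 - 2 * s)) ≤ Real.exp (s + 2 * s ^ 2) := by
  obtain ⟨h1, h2⟩ := abs_le.1 hs
  have hpos : 0 < 1 - 2 * s := by linarith
  rw [Real.sqrt_le_left (Real.exp_pos _).le, ← Real.exp_nat_mul, div_le_iff₀ hpos]
  push_cast
  rcases le_total 0 s with h | h
  · have hq := Real.quadratic_le_exp_of_nonneg (x := 2 * (s + 2 * s ^ 2)) (by positivity)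
    refine le_trans ?_ (mul_le_mul_of_nonneg_right hq hpos.le)
    nlinarith [mul_nonneg h h, mul_nonneg (mul_nonneg h h) (sub_nonneg.2 h2),
      mul_nonneg (mul_nonneg (mul_nonneg h h) h) (sub_nonneg.2 h2),
      mul_nonneg (mul_nonneg (mul_nonneg h h) (mul_nonneg h h)) (sub_nonneg.2 h2)]
  · have hl := Real.le_log_one_add_of_nonneg (x := -(2 * s)) (by linarith)
    have hl2 : -(2 * (s + 2 * s ^ 2)) ≤ 2 * (-(2 * s)) / (-(2 * s) + 2) := by
      rw [le_div_iff₀ (by linarith)]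
      nlinarith [mul_nonneg (neg_nonneg.2 h) (neg_nonneg.2 h),
        mul_nonneg (mul_nonneg (neg_nonneg.2 h) (neg_nonneg.2 h)) (neg_nonneg.2 h)]
    have h3 : Real.exp (-(2 * (s + 2 * s ^ 2))) ≤ 1 - 2 * s := by
      rw [← Real.le_log_iff_exp_le hpos]
      have e : 1 - 2 * s = 1 + -(2 * s) := by ring
      rw [e]; linarith
    calc (1 : ℝ) = Real.exp (2 * (s + 2 * s ^ 2)) * Real.exp (-(2 * (s + 2 * s ^ 2))) := by
          rw [← Real.exp_add]; simp
      _ ≤ _ := by gcongr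

variable {v : ℝ≥0} {s : ℝ}

lemma gaussianPDFReal_smul_exp_sq (hv : v ≠ 0) (x : ℝ) :
    gaussianPDFReal 0 v x • Real.exp (s / v * x ^ 2)
      = (√(2 * Real.pi * v))⁻¹ * Real.exp (-((1 - 2 * s) / (2 * v)) * x ^ 2) := by
  have hv' : (v : ℝ) ≠ 0 := by exact_mod_cast hv
  rw [gaussianPDFReal, smul_eq_mul, mul_assoc, ← Real.exp_add]
  congr 2
  field_simp
  ring

lemma integrable_exp_sq_gaussianReal (hv : v ≠ 0) (hs : |s| ≤ 1 / 4) :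
    Integrable (fun x => Real.exp (s / v * x ^ 2)) (gaussianReal 0 v) := by
  have hv' : (0 : ℝ) < v := by exact_mod_cast pos_iff_ne_zero.2 hv
  rw [gaussianReal_of_var_ne_zero _ hv, integrable_withDensity_iff_integrable_smul'
    (measurable_gaussianPDF _ _) (Filter.Eventually.of_forall fun _ => gaussianPDF_lt_top)]
  simp only [toReal_gaussianPDF, gaussianPDFReal_smul_exp_sq hv]
  refine (integrable_exp_neg_mul_sq ?_).const_mul _
  have := (abs_le.1 hs).2
  apply div_pos <;> linarith

lemma integral_exp_sq_gaussianReal_le (hv : v ≠ 0) (hs : |s| ≤ 1 / 4) :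
    ∫ x, Real.exp (s / v * x ^ 2) ∂(gaussianReal 0 v) ≤ Real.exp (s + 2 * s ^ 2) := by
  have hv' : (0 : ℝ) < v := by exact_mod_cast pos_iff_ne_zero.2 hv
  rw [integral_gaussianReal_eq_integral_smul hv]
  simp only [gaussianPDFReal_smul_exp_sq hv]
  rw [integral_const_mul, integral_gaussian, ← Real.sqrt_inv, ← Real.sqrt_mul (by positivity)]
  refine le_trans (le_of_eq ?_) (sqrt_inv_one_sub_le_exp hs)
  have h := (abs_le.1 hs).2
  have hpos : 1 - 2 * s ≠ 0 := by linarith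
  congr 1
  have := Real.pi_pos.ne'
  field_simp

variable {n : ℕ}

lemma exp_mul_sum_sq (c : ℝ) (y : Fin n → ℝ) :
    Real.exp (c * ∑ l, y l ^ 2) = ∏ l, Real.exp (c * y l ^ 2) := by
  rw [← Real.exp_sum, Finset.mul_sum]

lemma integrable_exp_sum_sq (hv : v ≠ 0) (hs : |s| ≤ 1 / 4) :
    Integrable (fun y : Fin n → ℝ => Real.exp (s / v * ∑ l, y l ^ 2))
      (Measure.pi fun _ => gaussianReal 0 v) := by
  simp only [exp_mul_sum_sq]
  exact Integrable.fintype_prod fun _ => integrable_exp_sq_gaussianReal hv hs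

lemma mgf_sum_sq_le (hv : v ≠ 0) (hs : |s| ≤ 1 / 4) :
    mgf (fun y : Fin n → ℝ => ∑ l, y l ^ 2) (Measure.pi fun _ => gaussianReal 0 v) (s / v)
      ≤ Real.exp (n * (s + 2 * s ^ 2)) := by
  simp only [mgf, exp_mul_sum_sq]
  rw [integral_fintype_prod_eq_pow (fun x => Real.exp (s / v * x ^ 2)), Fintype.card_fin,
    Real.exp_nat_mul]
  exact pow_le_pow_left₀ (integral_nonneg fun _ => (Real.exp_pos _).le)
    (integral_exp_sq_gaussianReal_le hv hs) n

/-- Upper tail of the chi-squared distribution. -/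
lemma pi_gaussianReal_sum_sq_ge (hv : v ≠ 0) {t : ℝ} (ht0 : 0 ≤ t) (ht1 : t ≤ 1) :
    (Measure.pi fun _ : Fin n => gaussianReal 0 v).real {y | (1 + t) * v * n ≤ ∑ l, y l ^ 2}
      ≤ Real.exp (-(t ^ 2 / 8 * n)) := by
  have hv' : (0 : ℝ) < v := by exact_mod_cast pos_iff_ne_zero.2 hv
  have hs : |t / 4| ≤ 1 / 4 := by rw [abs_of_nonneg (by positivity)]; linarith
  refine (measure_ge_le_exp_mul_mgf ((1 + t) * v * n) (t := t / 4 / v) (by positivity)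
    (integrable_exp_sum_sq hv hs)).trans ?_
  refine (mul_le_mul_of_nonneg_left (mgf_sum_sq_le hv hs) (Real.exp_pos _).le).trans (le_of_eq ?_)
  rw [← Real.exp_add]
  congr 1
  field_simp
  ring

/-- Lower tail of the chi-squared distribution. -/
lemma pi_gaussianReal_sum_sq_le (hv : v ≠ 0) {t : ℝ} (ht0 : 0 ≤ t) (ht1 : t ≤ 1) :
    (Measure.pi fun _ : Fin n => gaussianReal 0 v).real {y | ∑ l, y l ^ 2 ≤ (1 - t) * v * n}
      ≤ Real.exp (-(t ^ 2 / 8 * n)) := by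
  have hv' : (0 : ℝ) < v := by exact_mod_cast pos_iff_ne_zero.2 hv
  have hs : |-(t / 4)| ≤ 1 / 4 := by rw [abs_neg, abs_of_nonneg (by positivity)]; linarith
  refine (measure_le_le_exp_mul_mgf ((1 - t) * v * n) (t := -(t / 4) / v) ?_
    (integrable_exp_sum_sq hv hs)).trans ?_
  · rw [neg_div, neg_nonpos]; positivity
  refine (mul_le_mul_of_nonneg_left (mgf_sum_sq_le hv hs) (Real.exp_pos _).le).trans (le_of_eq ?_)
  rw [← Real.exp_add]
  congr 1
  field_simp
  ring

lemma gaussianReal_ge_le_exp {V ε : ℝ} (hV : 0 < V) (hvV : v ≤ V) (hε : 0 ≤ ε) :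
    (gaussianReal 0 v).real {x | ε ≤ x} ≤ Real.exp (-(ε ^ 2 / (2 * V))) := by
  refine (measure_ge_le_exp_mul_mgf (X := id) ε (t := ε / V) (by positivity)
    (integrable_exp_mul_gaussianReal _)).trans ?_
  rw [mgf_id_gaussianReal, ← Real.exp_add, Real.exp_le_exp, zero_mul, zero_add]
  have h1 : v * (ε / V) ^ 2 / 2 ≤ V * (ε / V) ^ 2 / 2 := by gcongr
  have h2 : -(ε / V) * ε + V * (ε / V) ^ 2 / 2 = -(ε ^ 2 / (2 * V)) := by field_simp; ring
  linarith

lemma gaussianReal_abs_ge_le_exp {V ε : ℝ} (hV : 0 < V) (hvV : v ≤ V) (hε : 0 ≤ ε) :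
    (gaussianReal 0 v).real {x | ε ≤ |x|} ≤ 2 * Real.exp (-(ε ^ 2 / (2 * V))) := by
  have h1 := gaussianReal_ge_le_exp hV hvV hε
  have h2 : (gaussianReal 0 v).real {x | ε ≤ -x} ≤ Real.exp (-(ε ^ 2 / (2 * V))) := by
    have : gaussianReal 0 v = (gaussianReal 0 v).map (fun x => -x) := by
      rw [gaussianReal_map_neg, neg_zero]
    rw [this, map_measureReal_apply measurable_neg (measurableSet_le measurable_const
      measurable_neg)]
    simpa using h1
  have : {x : ℝ | ε ≤ |x|} = {x | ε ≤ x} ∪ {x | ε ≤ -x} := by ext x; simp [le_abs]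
  rw [this, two_mul]
  exact (measureReal_union_le _ _).trans (add_le_add h1 h2)

/-- A linear combination of independent standard Gaussian variables. -/
lemma map_sum_mul_pi_gaussianReal {m : ℕ} (z : Fin m → ℝ) :
    (Measure.pi fun _ : Fin m => gaussianReal 0 1).map (fun x => ∑ j, x j * z j)
      = gaussianReal 0 (∑ j, z j ^ 2).toNNReal := by
  have hlaw : ∀ j, HasGaussianLaw (fun x : Fin m → ℝ => x j * z j)
      (Measure.pi fun _ : Fin m => gaussianReal 0 1) := by
    intro j
    refine ⟨?_⟩
    have : (fun x : Fin m → ℝ => x j * z j) = (fun y => y * z j) ∘ (fun x => x j) := rfl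
    rw [this, ← Measure.map_map (by fun_prop) (by fun_prop),
      (measurePreserving_eval (fun _ : Fin m => gaussianReal 0 1) j).map_eq,
      gaussianReal_map_mul_const]
    infer_instance
  have hind : iIndepFun (fun (j : Fin m) (x : Fin m → ℝ) => x j * z j)
      (Measure.pi fun _ : Fin m => gaussianReal 0 1) :=
    iIndepFun_pi (X := fun j y => y * z j) fun j => by fun_prop
  have hsum := hind.hasGaussianLaw_fun_sum hlaw
  rw [hsum.map_eq_gaussianReal]
  have hmem : ∀ j : Fin m, MemLp (fun y => y * z j) 2 (gaussianReal 0 1) := fun j =>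
    (memLp_id_gaussianReal 2).mul_const (z j)
  congr 1
  · rw [integral_finsetSum _ fun j _ => (hlaw j).integrable]
    refine Finset.sum_eq_zero fun j _ => ?_
    rw [integral_comp_eval (μ := fun _ : Fin m => gaussianReal 0 1) (f := fun y => y * z j)
      (by fun_prop), integral_mul_const, integral_id_gaussianReal, zero_mul]
  · have := variance_sum_pi (μ := fun _ : Fin m => gaussianReal 0 1) hmem
    have e : (∑ j, fun ω : Fin m → ℝ => ω j * z j) = fun ω => ∑ j, ω j * z j := by
      ext; simp
    rw [e] at this
    rw [this]
    congr 1
    refine Finset.sum_congr rfl fun j _ => ?_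
    rw [variance_mul_const, variance_fun_id_gaussianReal]
    simp

end Gaussian

/-! ### Regular samples are likely -/

section Regularity

variable {p k n : ℕ}

/-- The law of the design matrix: i.i.d. standard Gaussian entries. -/
noncomputable def designLaw (n p : ℕ) : Measure (Fin n → Fin p → ℝ) :=
  Measure.pi fun _ : Fin n => Measure.pi fun _ : Fin p => gaussianReal 0 1

/-- The law of the noise: i.i.d. centred Gaussian entries of variance `σ²`. -/
noncomputable def noiseLaw (n : ℕ) (σ : ℝ≥0) : Measure (Fin n → ℝ) :=
  Measure.pi fun _ : Fin n => gaussianReal 0 (σ ^ 2)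

instance : IsProbabilityMeasure (designLaw n p) := by unfold designLaw; infer_instance

instance (σ : ℝ≥0) : IsProbabilityMeasure (noiseLaw n σ) := by unfold noiseLaw; infer_instance

lemma designLaw_map_apply (z : Fin p → ℝ) :
    (designLaw n p).map (fun X l => ∑ j, X l j * z j)
      = Measure.pi fun _ : Fin n => gaussianReal 0 (∑ j, z j ^ 2).toNNReal := by
  have : ∀ _ : Fin n, IsProbabilityMeasure
      ((Measure.pi fun _ : Fin p => gaussianReal 0 1).map fun x => ∑ j, x j * z j) := fun _ =>
    Measure.isProbabilityMeasure_map (Measurable.aemeasurable (by fun_prop))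
  rw [designLaw, Measure.pi_map_pi (f := fun (_ : Fin n) (x : Fin p → ℝ) => ∑ j, x j * z j)
    fun _ => Measurable.aemeasurable (by fun_prop)]
  simp only [map_sum_mul_pi_gaussianReal]

lemma designLaw_map_column (j : Fin p) :
    (designLaw n p).map (fun X l => X l j) = Measure.pi fun _ : Fin n => gaussianReal 0 1 := by
  have h : ∀ _ : Fin n, (Measure.pi fun _ : Fin p => gaussianReal 0 1).map (fun x => x j)
      = gaussianReal 0 1 := fun _ =>
    (measurePreserving_eval (fun _ : Fin p => gaussianReal 0 1) j).map_eq
  have : ∀ _ : Fin n, IsProbabilityMeasure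
      ((Measure.pi fun _ : Fin p => gaussianReal 0 1).map fun x => x j) := fun _ =>
    Measure.isProbabilityMeasure_map (Measurable.aemeasurable (by fun_prop))
  rw [designLaw, Measure.pi_map_pi (f := fun (_ : Fin n) (x : Fin p → ℝ) => x j)
    fun _ => Measurable.aemeasurable (by fun_prop)]
  exact congrArg Measure.pi (funext h)

lemma designLaw_sqNorm_ge (z : Fin p → ℝ) (hz : 0 < ∑ j, z j ^ 2) {t : ℝ} (ht0 : 0 ≤ t)
    (ht1 : t ≤ 1) :
    (designLaw n p).real {X | (1 + t) * (∑ j, z j ^ 2) * n ≤ sqNormApply X z}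
      ≤ Real.exp (-(t ^ 2 / 8 * n)) := by
  have h := pi_gaussianReal_sum_sq_ge (n := n) (Real.toNNReal_pos.2 hz).ne' ht0 ht1
  rw [← designLaw_map_apply, map_measureReal_apply (by fun_prop)
    (measurableSet_le (by fun_prop) (by fun_prop)), Real.coe_toNNReal _ hz.le] at h
  exact h

lemma designLaw_sqNorm_le (z : Fin p → ℝ) (hz : 0 < ∑ j, z j ^ 2) {t : ℝ} (ht0 : 0 ≤ t)
    (ht1 : t ≤ 1) :
    (designLaw n p).real {X | sqNormApply X z ≤ (1 - t) * (∑ j, z j ^ 2) * n}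
      ≤ Real.exp (-(t ^ 2 / 8 * n)) := by
  have h := pi_gaussianReal_sum_sq_le (n := n) (Real.toNNReal_pos.2 hz).ne' ht0 ht1
  rw [← designLaw_map_apply, map_measureReal_apply (by fun_prop)
    (measurableSet_le (by fun_prop) (by fun_prop)), Real.coe_toNNReal _ hz.le] at h
  exact h

lemma designLaw_column_sub_ge {i j : Fin p} (hij : i ≠ j) :
    (designLaw n p).real {X | (1 + 1 / 24) * 2 * n ≤ ∑ l, (X l i - X l j) ^ 2}
      ≤ Real.exp (-(n / 4608)) := by
  set z : Fin p → ℝ := fun m => (if m = i then 1 else 0) - (if m = j then 1 else 0) with hz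
  have e1 : ∑ m, z m ^ 2 = 2 := by
    have : ∀ m, z m ^ 2 = (if m = i then 1 else 0) + (if m = j then 1 else 0) := by
      intro m
      simp only [hz]
      by_cases h1 : m = i
      · have h2 : m ≠ j := h1 ▸ hij
        simp [h1, hij]
      · by_cases h2 : m = j
        · simp [h2, hij.symm]
        · simp [h1, h2]
    simp only [this, Finset.sum_add_distrib]
    norm_num
  have e2 : ∀ X : Fin n → Fin p → ℝ, sqNormApply X z = ∑ l, (X l i - X l j) ^ 2 := by
    intro X
    refine Finset.sum_congr rfl fun l _ => ?_
    simp [hz, mul_sub, Finset.sum_sub_distrib]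
  have h := designLaw_sqNorm_ge (n := n) z (by rw [e1]; norm_num) (t := 1 / 24) (by norm_num)
    (by norm_num)
  simp only [e1, e2] at h
  refine h.trans (le_of_eq ?_)
  congr 1; ring

lemma designLaw_column_noise_ge (W : Fin n → ℝ) (j : Fin p) {V ε : ℝ} (hV : 0 < V)
    (hWV : ∑ l, W l ^ 2 ≤ V) (hε : 0 ≤ ε) :
    (designLaw n p).real {X | ε ≤ |∑ l, W l * X l j|} ≤ 2 * Real.exp (-(ε ^ 2 / (2 * V))) := by
  have h := gaussianReal_abs_ge_le_exp (v := (∑ l, W l ^ 2).toNNReal) hV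
    (by rw [Real.coe_toNNReal _ (Finset.sum_nonneg fun l _ => sq_nonneg _)]; exact hWV) hε
  rw [← map_sum_mul_pi_gaussianReal, ← designLaw_map_column j,
    Measure.map_map (by fun_prop) (by fun_prop), map_measureReal_apply (by fun_prop)
    (measurableSet_le (by fun_prop) (by fun_prop))] at h
  simpa [Function.comp_def, mul_comm] using h

/-- Conditionally on a noise vector of typical length, its inner product with a column of the design
is a centred Gaussian of variance at most `2 σ² n`. -/
lemma prod_column_noise_ge {σ : ℝ≥0} (hσ : 0 < σ) (hn : 0 < n) (j : Fin p) :
    ((designLaw n p).prod (noiseLaw n σ)).real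
      {q | n / 16 ≤ |∑ l, q.2 l * q.1 l j| ∧ ∑ l, q.2 l ^ 2 ≤ 2 * σ ^ 2 * n}
      ≤ 2 * Real.exp (-(n / (1024 * σ ^ 2))) := by
  have hσ' : (0 : ℝ) < σ := by exact_mod_cast hσ
  have hn' : (0 : ℝ) < n := by exact_mod_cast hn
  set b := 2 * Real.exp (-(n / (1024 * (σ : ℝ) ^ 2))) with hb
  have hb0 : 0 ≤ b := by positivity
  have hmeas₁ : MeasurableSet {q : (Fin n → Fin p → ℝ) × (Fin n → ℝ) |
      (n : ℝ) / 16 ≤ |∑ l, q.2 l * q.1 l j|} := measurableSet_le (by fun_prop) (by fun_prop)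
  have hmeas₂ : MeasurableSet {q : (Fin n → Fin p → ℝ) × (Fin n → ℝ) |
      ∑ l, q.2 l ^ 2 ≤ 2 * (σ : ℝ) ^ 2 * n} := measurableSet_le (by fun_prop) (by fun_prop)
  have hmeas : MeasurableSet {q : (Fin n → Fin p → ℝ) × (Fin n → ℝ) |
      (n : ℝ) / 16 ≤ |∑ l, q.2 l * q.1 l j| ∧ ∑ l, q.2 l ^ 2 ≤ 2 * (σ : ℝ) ^ 2 * n} :=
    hmeas₁.inter hmeas₂
  rw [measureReal_def, Measure.prod_apply_symm hmeas]
  refine ENNReal.toReal_le_of_le_ofReal hb0 ?_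
  calc _ ≤ ∫⁻ _, ENNReal.ofReal b ∂(noiseLaw n σ) := by
        refine lintegral_mono fun W => ?_
        by_cases hW : ∑ l, W l ^ 2 ≤ 2 * (σ : ℝ) ^ 2 * n
        · have h := designLaw_column_noise_ge (p := p) W j (V := 2 * (σ : ℝ) ^ 2 * n)
            (ε := (n : ℝ) / 16) (by positivity) hW (by positivity)
          have e : ((n : ℝ) / 16) ^ 2 / (2 * (2 * (σ : ℝ) ^ 2 * n)) = n / (1024 * (σ : ℝ) ^ 2) := by
            field_simp; norm_num
          rw [e] at h
          rw [← ENNReal.ofReal_toReal (measure_ne_top (designLaw n p) _)]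
          refine ENNReal.ofReal_le_ofReal (le_trans ?_ h)
          exact measureReal_mono fun X hX => hX.1
        · have : (fun X : Fin n → Fin p → ℝ => (X, W)) ⁻¹' {q |
              (n : ℝ) / 16 ≤ |∑ l, q.2 l * q.1 l j| ∧ ∑ l, q.2 l ^ 2 ≤ 2 * (σ : ℝ) ^ 2 * n}
              = ∅ := by
            ext X; simp [hW]
          rw [this]; simp
    _ = ENNReal.ofReal b := by simp

lemma prod_real_fst {E : Set (Fin n → Fin p → ℝ)} {σ : ℝ≥0} :
    ((designLaw n p).prod (noiseLaw n σ)).real {q | q.1 ∈ E} = (designLaw n p).real E := by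
  have : {q : (Fin n → Fin p → ℝ) × (Fin n → ℝ) | q.1 ∈ E} = E ×ˢ Set.univ := by ext; simp
  rw [this, measureReal_prod_prod, probReal_univ, mul_one]

lemma prod_real_snd {E : Set (Fin n → ℝ)} {σ : ℝ≥0} :
    ((designLaw n p).prod (noiseLaw n σ)).real {q | q.2 ∈ E} = (noiseLaw n σ).real E := by
  have : {q : (Fin n → Fin p → ℝ) × (Fin n → ℝ) | q.2 ∈ E} = Set.univ ×ˢ E := by ext; simp
  rw [this, measureReal_prod_prod, probReal_univ, one_mul]

/-- The union bound over the sparse vectors, the pairs of columns, and the columns. -/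
lemma prod_not_isRegularSample_le {σ : ℝ≥0} (hσ : 0 < σ) (hn : 0 < n) (S : SparseVec p k) :
    ((designLaw n p).prod (noiseLaw n σ)).real {q | ¬ IsRegularSample q.1 q.2 S}
      ≤ 2 * Fintype.card (SparseVec p k) * Real.exp (-(n / 4608))
        + p ^ 2 * Real.exp (-(n / 4608)) + Real.exp (-(n / 8))
        + 2 * p * Real.exp (-(n / (1024 * σ ^ 2))) := by
  set ν := (designLaw n p).prod (noiseLaw n σ) with hν
  set u : SparseVec p k → Fin p → ℝ := fun v j => S.toVec j - v.toVec j with hu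
  set A₁ : Set ((Fin n → Fin p → ℝ) × (Fin n → ℝ)) := ⋃ v ∈ Finset.univ.erase S,
    ({q | q.1 ∈ {X | sqNormApply X (u v) ≤ (1 - 1 / 24) * (∑ j, u v j ^ 2) * n}}
      ∪ {q | q.1 ∈ {X | (1 + 1 / 24) * (∑ j, u v j ^ 2) * n ≤ sqNormApply X (u v)}}) with hA₁
  set A₂ : Set ((Fin n → Fin p → ℝ) × (Fin n → ℝ)) := ⋃ e ∈ Finset.univ.offDiag,
    {q | q.1 ∈ {X : Fin n → Fin p → ℝ |
      (1 + 1 / 24) * 2 * (n : ℝ) ≤ ∑ l, (X l e.1 - X l e.2) ^ 2}} with hA₂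
  set A₃ : Set ((Fin n → Fin p → ℝ) × (Fin n → ℝ)) :=
    {q | q.2 ∈ {W : Fin n → ℝ | (1 + 1) * ((σ ^ 2 : ℝ≥0) : ℝ) * n ≤ ∑ l, W l ^ 2}} with hA₃
  set A₄ : Set ((Fin n → Fin p → ℝ) × (Fin n → ℝ)) := ⋃ j ∈ (Finset.univ : Finset (Fin p)),
    {q | (n : ℝ) / 16 ≤ |∑ l, q.2 l * q.1 l j| ∧ ∑ l, q.2 l ^ 2 ≤ 2 * (σ : ℝ) ^ 2 * n} with hA₄
  have hexp : -((1 / 24 : ℝ) ^ 2 / 8 * n) = -(n / 4608) := by ring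
  have h1 : ν.real A₁ ≤ 2 * Fintype.card (SparseVec p k) * Real.exp (-(n / 4608)) := by
    refine (measureReal_biUnion_finset_le _ _).trans ?_
    calc _ ≤ ∑ v ∈ Finset.univ.erase S, 2 * Real.exp (-((n : ℝ) / 4608)) := by
          refine Finset.sum_le_sum fun v hv => ?_
          have hpos : 0 < ∑ j, u v j ^ 2 := by
            simp only [hu]
            rw [SparseVec.sum_sq_sub_toVec]
            have := Finset.card_pos.2 (SparseVec.sdiff_nonempty (Finset.ne_of_mem_erase hv))
            positivity
          refine (measureReal_union_le _ _).trans ?_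
          rw [hν, prod_real_fst, prod_real_fst, two_mul, ← hexp]
          exact add_le_add (designLaw_sqNorm_le _ hpos (by norm_num) (by norm_num))
            (designLaw_sqNorm_ge _ hpos (by norm_num) (by norm_num))
      _ ≤ ∑ v : SparseVec p k, 2 * Real.exp (-((n : ℝ) / 4608)) :=
          Finset.sum_le_sum_of_subset_of_nonneg (Finset.subset_univ _)
            fun _ _ _ => by positivity
      _ = _ := by rw [Finset.sum_const, Finset.card_univ, nsmul_eq_mul]; ring
  have h2 : ν.real A₂ ≤ p ^ 2 * Real.exp (-(n / 4608)) := by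
    refine (measureReal_biUnion_finset_le _ _).trans ?_
    calc _ ≤ ∑ e ∈ (Finset.univ : Finset (Fin p)).offDiag, Real.exp (-((n : ℝ) / 4608)) := by
          refine Finset.sum_le_sum fun e he => ?_
          rw [hν, prod_real_fst]
          exact designLaw_column_sub_ge (Finset.mem_offDiag.1 he).2.2
      _ ≤ ∑ e : Fin p × Fin p, Real.exp (-((n : ℝ) / 4608)) :=
          Finset.sum_le_sum_of_subset_of_nonneg (Finset.subset_univ _)
            fun _ _ _ => (Real.exp_pos _).le
      _ = _ := by
          rw [Finset.sum_const, Finset.card_univ, nsmul_eq_mul, Fintype.card_prod,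
            Fintype.card_fin]
          push_cast; ring
  have h3 : ν.real A₃ ≤ Real.exp (-(n / 8)) := by
    rw [hν, hA₃, prod_real_snd]
    refine (pi_gaussianReal_sum_sq_ge (pow_pos hσ 2).ne' (t := 1) (by norm_num) le_rfl).trans
      (le_of_eq ?_)
    congr 1; ring
  have h4 : ν.real A₄ ≤ 2 * p * Real.exp (-(n / (1024 * σ ^ 2))) := by
    refine (measureReal_biUnion_finset_le _ _).trans ?_
    refine (Finset.sum_le_sum fun j _ => prod_column_noise_ge hσ hn j).trans (le_of_eq ?_)
    rw [Finset.sum_const, Finset.card_univ, nsmul_eq_mul, Fintype.card_fin]; ring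
  have hsub : {q : (Fin n → Fin p → ℝ) × (Fin n → ℝ) | ¬ IsRegularSample q.1 q.2 S}
      ⊆ A₁ ∪ A₂ ∪ A₃ ∪ A₄ := by
    intro q hq
    by_contra hc
    simp only [Set.mem_union, not_or] at hc
    obtain ⟨⟨⟨c1, c2⟩, c3⟩, c4⟩ := hc
    simp only [hA₁, hA₂, hA₃, hA₄, Set.mem_iUnion, Set.mem_union, Set.mem_ofPred_eq, not_exists,
      not_or, not_le, not_and, Finset.mem_erase, Finset.mem_univ, and_true,
      Finset.mem_offDiag, true_and, forall_true_left] at c1 c2 c3 c4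
    refine hq ⟨fun v hv => (c1 v hv).1.le, fun v hv => (c1 v hv).2.le,
      fun i j hij => (c2 (i, j) hij).le, fun j => ?_⟩
    by_contra hj
    have hlt := c4 j (not_le.1 hj).le
    push_cast at c3
    linarith
  calc ν.real _ ≤ ν.real (A₁ ∪ A₂ ∪ A₃ ∪ A₄) := measureReal_mono hsub
    _ ≤ ν.real A₁ + ν.real A₂ + ν.real A₃ + ν.real A₄ := by
        refine (measureReal_union_le _ _).trans (add_le_add_left ?_ _)
        refine (measureReal_union_le _ _).trans (add_le_add_left ?_ _)
        exact measureReal_union_le _ _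
    _ ≤ _ := by linarith

/-- Since the signal takes finitely many values, it suffices to bound the failure probability given
each of them; no measurability is needed. -/
lemma srLaw_le_of_forall {σ : ℝ≥0} {E : SparseVec p k → Set ((Fin n → Fin p → ℝ) × (Fin n → ℝ))}
    {b : ℝ≥0∞} (hE : ∀ S, (designLaw n p).prod (noiseLaw n σ) (E S) ≤ b) :
    srLaw p k n σ {ω | ω.2 ∈ E ω.1} ≤ b := by
  have hset : {ω : SRSample p k n | ω.2 ∈ E ω.1}
      = ⋃ S ∈ (Finset.univ : Finset (SparseVec p k)), {S} ×ˢ E S := by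
    ext ω; simp [Set.mem_prod]
  have hu : uniformOn (Set.univ : Set (SparseVec p k)) Set.univ ≤ 1 := by
    rcases isEmpty_or_nonempty (SparseVec p k) with h | h
    · simp [Set.univ_eq_empty_iff.2 h]
    · have := isProbabilityMeasure_uniformOn (Set.finite_univ (α := SparseVec p k))
        Set.univ_nonempty
      exact prob_le_one
  rw [hset]
  refine (measure_biUnion_finset_le _ _).trans ?_
  calc _ ≤ ∑ S : SparseVec p k, uniformOn (Set.univ : Set (SparseVec p k)) {S} * b := by
        refine Finset.sum_le_sum fun S _ => ?_
        refine (Measure.prod_prod_le _ _).trans ?_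
        exact mul_le_mul_right (hE S) _
    _ = uniformOn (Set.univ : Set (SparseVec p k)) Set.univ * b := by
        rw [← Finset.sum_mul, sum_measure_singleton, Finset.coe_univ]
    _ ≤ b := mul_le_of_le_one_left' hu

end Regularity

/-! ### Numerical estimates -/

section Numerics

variable {p k n : ℕ}

lemma one_le_log_div (hk : 0 < k) (hp : 3 * k ≤ p) : 1 ≤ Real.log (p / k) := by
  have hk' : (0 : ℝ) < k := by exact_mod_cast hk
  have hp' : (3 : ℝ) * k ≤ p := by exact_mod_cast hp
  have h3 : (3 : ℝ) ≤ p / k := by rwa [le_div_iff₀ hk']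
  rw [Real.le_log_iff_exp_le (by linarith)]
  linarith [Real.exp_one_lt_d9]

lemma log_le_mul_log_div (hk : 0 < k) (hp : 3 * k ≤ p) :
    Real.log p ≤ k * Real.log (p / k) := by
  have hk' : (1 : ℝ) ≤ k := by exact_mod_cast hk
  have hp' : (3 : ℝ) * k ≤ p := by exact_mod_cast hp
  have h1 := one_le_log_div hk hp
  have h2 : Real.log (p / k) = Real.log p - Real.log k :=
    Real.log_div (by linarith) (by linarith)
  have h3 := Real.log_le_sub_one_of_pos (show (0 : ℝ) < k by linarith)
  nlinarith

/-- The bound `p.choose k ≤ (e p / k) ^ k`, in logarithmic form. -/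
lemma log_card_sparseVec_le (hk : 0 < k) (hp : 3 * k ≤ p) :
    Real.log (Fintype.card (SparseVec p k)) ≤ k * Real.log (p / k) + k := by
  have hk' : (0 : ℝ) < k := by exact_mod_cast hk
  have hp' : (3 : ℝ) * k ≤ p := by exact_mod_cast hp
  have hcard : Fintype.card (SparseVec p k) = p.choose k := by
    rw [Fintype.card_finset_len, Fintype.card_fin]
  have hpos : (0 : ℝ) < p.choose k := by exact_mod_cast Nat.choose_pos (by omega)
  rw [hcard, Real.log_le_iff_le_exp hpos, Real.exp_add, Real.exp_nat_mul,
    Real.exp_log (by apply div_pos <;> linarith)]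
  calc (p.choose k : ℝ) ≤ p ^ k / k.factorial := Nat.choose_le_pow_div k p
    _ = (p / k : ℝ) ^ k * ((k : ℝ) ^ k / k.factorial) := by
        rw [div_pow]; field_simp
    _ ≤ _ := by
        gcongr
        exact Real.pow_div_factorial_le_exp k hk'.le k

lemma card_sparseVec_le_exp (hk : 0 < k) (hp : 3 * k ≤ p) :
    (Fintype.card (SparseVec p k) : ℝ) ≤ Real.exp (2 * (k * Real.log (p / k))) := by
  have h1 := log_card_sparseVec_le hk hp
  have h2 := one_le_log_div hk hp
  have hk' : (0 : ℝ) < k := by exact_mod_cast hk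
  rcases (Nat.cast_nonneg (α := ℝ) (Fintype.card (SparseVec p k))).eq_or_lt with h | h
  · rw [← h]; positivity
  · rw [← Real.log_le_iff_le_exp h]
    nlinarith

lemma exp_neg_two_mul_le (hk : 0 < k) (hp : 3 * k ≤ p) :
    Real.exp (-(2 * (k * Real.log (p / k)))) ≤ 1 / p ^ 2 := by
  have hp' : (0 : ℝ) < p := by exact_mod_cast (by omega : 0 < p)
  calc _ ≤ Real.exp (-(2 * Real.log p)) := by
        rw [Real.exp_le_exp]; linarith [log_le_mul_log_div hk hp]
    _ = 1 / p ^ 2 := by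
        rw [Real.exp_neg, one_div, show 2 * Real.log p = ((2 : ℕ) : ℝ) * Real.log p by norm_num,
          Real.exp_nat_mul, Real.exp_log hp']

/-- The noise level is small against the sample size. For `p ≥ k²` this follows from `σ² ≤ c k`,
as `log p ≤ 2 log (p / k)`; for `p < k²` from `σ² ≤ c log p`, as `(log p)² = O(k)`. -/
lemma sq_mul_log_le {σ : ℝ} (hk : 100 ≤ k) (hp : 3 * k ≤ p)
    (hσ : σ ^ 2 ≤ 1 / 2 * min (Real.log p / Real.log (Real.log p)) k) :
    σ ^ 2 * Real.log p ≤ 8 * (k * Real.log (p / k)) := by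
  have hk' : (100 : ℝ) ≤ k := by exact_mod_cast hk
  have hp' : (3 : ℝ) * k ≤ p := by exact_mod_cast hp
  have h1 := one_le_log_div (by omega) hp
  have h2 : Real.log (p / k) = Real.log p - Real.log k :=
    Real.log_div (by linarith) (by linarith)
  have hlogp : Real.exp 1 ≤ Real.log p := by
    rw [Real.le_log_iff_exp_le (by linarith)]
    have h3 : Real.exp 1 ≤ 3 := by linarith [Real.exp_one_lt_d9]
    calc Real.exp (Real.exp 1) ≤ Real.exp 3 := Real.exp_le_exp.2 h3
      _ = Real.exp 1 ^ 3 := by rw [← Real.exp_nat_mul]; norm_num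
      _ ≤ 3 ^ 3 := by gcongr
      _ ≤ p := by linarith
  have hlogp0 : 0 < Real.log p := (Real.exp_pos 1).trans_le hlogp
  rcases le_or_gt ((k : ℝ) ^ 2) p with h | h
  · have h3 : 2 * Real.log k ≤ Real.log p := by
      have := Real.log_le_log (by positivity) h
      rwa [Real.log_pow, Nat.cast_ofNat] at this
    have h4 : σ ^ 2 ≤ 1 / 2 * k := hσ.trans (by gcongr; exact min_le_right _ _)
    have h5 : σ ^ 2 * Real.log p ≤ 1 / 2 * k * (2 * Real.log (p / k)) :=
      mul_le_mul h4 (by linarith) hlogp0.le (by positivity)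
    nlinarith
  · have h3 : Real.log p ≤ 2 * Real.log k := by
      have := Real.log_le_log (by linarith) h.le
      rwa [Real.log_pow, Nat.cast_ofNat] at this
    have h4 : 1 ≤ Real.log (Real.log p) := (Real.le_log_iff_exp_le hlogp0).2 hlogp
    have h5 : σ ^ 2 ≤ 1 / 2 * Real.log p := by
      refine hσ.trans ?_
      gcongr
      exact (min_le_left _ _).trans (div_le_self hlogp0.le h4)
    have h6 : Real.log k ≤ 2 * √k := by
      have := Real.log_le_sub_one_of_pos (Real.sqrt_pos.2 (show (0 : ℝ) < k by linarith))
      rw [Real.log_sqrt (by linarith)] at this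
      linarith
    have h7 := Real.sq_sqrt (show (0 : ℝ) ≤ k by linarith)
    have h8 : Real.log p ^ 2 ≤ (4 * √k) ^ 2 := by
      apply pow_le_pow_left₀ hlogp0.le; linarith
    have h9 : σ ^ 2 * Real.log p ≤ 1 / 2 * Real.log p ^ 2 := by nlinarith
    nlinarith

lemma johnsonGraph_maxDegree_pos (hk : 0 < k) (hp : 3 * k ≤ p) (S : SparseVec p k) :
    0 < (johnsonGraph p k).maxDegree := by
  obtain ⟨j, hj⟩ : S.1.Nonempty := Finset.card_pos.1 (by rw [S.2]; exact hk)
  obtain ⟨i, hi⟩ : ∃ i, i ∉ S.1 := by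
    by_contra! h
    have := Finset.card_le_card (fun i _ => h i : (Finset.univ : Finset (Fin p)) ⊆ S.1)
    rw [Finset.card_univ, Fintype.card_fin, S.2] at this
    omega
  refine lt_of_lt_of_le ?_ ((johnsonGraph p k).degree_le_maxDegree S)
  exact (SimpleGraph.degree_pos_iff_exists_adj _ _).2 ⟨_, S.adj_swap hi hj⟩

end Numerics

/-! ### Running times on a regular sample -/

section Outputs

variable {p k n : ℕ} {X : Fin n → Fin p → ℝ} {W : Fin n → ℝ} {S : SparseVec p k}

lemma cast_maxDegree_le : ((johnsonGraph p k).maxDegree : ℝ) ≤ k * p := by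
  exact_mod_cast johnsonGraph_maxDegree_le

lemma range_div_gain (hn : 0 < n) : 3 * k * n / (3 / 2 * n) = (2 * k : ℝ) := by
  have hn' : (n : ℝ) ≠ 0 := by exact_mod_cast hn.ne'
  field_simp

lemma IsRegularSample.greedy_outputs (h : IsRegularSample X W S) (hk : 100 ≤ k)
    (hp : 3 * k ≤ p) (hn : 0 < n) :
    OutputsAfter (SRSample.greedy (S, X, W)) S (300 * (k ^ 2 * p)) (3 / 4) := by
  have hn' : (0 : ℝ) < n := by exact_mod_cast hn
  have hk' : (100 : ℝ) ≤ k := by exact_mod_cast hk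
  have hp' : (3 : ℝ) * k ≤ p := by exact_mod_cast hp
  refine greedy_outputsAfter h.gainAwayFrom (by positivity) h.hamiltonian_sub_le
    (johnsonGraph_maxDegree_pos (by omega) hp S) ?_
  rw [range_div_gain hn]
  have h1 : 4 * (2 * k) * ((johnsonGraph p k).maxDegree : ℝ) ≤ 4 * (2 * k) * (k * p) := by
    gcongr; exact cast_maxDegree_le
  have h2 : (1 : ℝ) ≤ k ^ 2 * p := one_le_mul_of_one_le_of_one_le (by nlinarith) (by linarith)
  linarith

lemma IsRegularSample.metropolis_outputs_slow (h : IsRegularSample X W S) (hk : 100 ≤ k)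
    (hp : 3 * k ≤ p) (hn : 0 < n) {β : ℝ} (hβ : 2 * (Real.log (k * p) / n) ≤ β) :
    OutputsAfter (SRSample.metropolis (S, X, W) β) S
      (100 * (k ^ 3 * p * (Real.log (p * Real.exp 1 / k) + β * n))) (3 / 4) := by
  have hn' : (0 : ℝ) < n := by exact_mod_cast hn
  have hk' : (100 : ℝ) ≤ k := by exact_mod_cast hk
  have hp' : (3 : ℝ) * k ≤ p := by exact_mod_cast hp
  have hkp : (10 : ℝ) ≤ k * p := by nlinarith
  have hβn : 2 * Real.log (k * p) ≤ β * n := by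
    rwa [← mul_div_assoc, div_le_iff₀ hn'] at hβ
  have hlog : 0 ≤ Real.log (k * p) := Real.log_nonneg (by linarith)
  have hβ0 : 0 ≤ β := le_trans (by positivity) hβ
  refine metropolis_outputsAfter_of_log_card h.gainAwayFrom (by positivity) h.hamiltonian_sub_le
    (johnsonGraph_maxDegree_pos (by omega) hp S) hβ0 ?_ ?_
  · calc ((johnsonGraph p k).maxDegree : ℝ) * Real.exp (-(β * (3 / 2 * n)))
        ≤ k * p * Real.exp (-(((3 : ℕ) : ℝ) * Real.log (k * p))) := by
          refine mul_le_mul cast_maxDegree_le (Real.exp_le_exp.2 ?_) (Real.exp_pos _).le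
            (by positivity)
          push_cast; linarith
      _ = 1 / (k * p) ^ 2 := by
          rw [Real.exp_neg, Real.exp_nat_mul, Real.exp_log (by linarith)]
          field_simp
      _ ≤ 1 / 10 ^ 2 := by gcongr
      _ = 1 / 100 := by norm_num
  · have h1 := log_card_sparseVec_le (p := p) (k := k) (by omega) hp
    have h2 := one_le_log_div (p := p) (k := k) (by omega) hp
    have h3 : Real.log (p * Real.exp 1 / k) = Real.log (p / k) + 1 := by
      rw [mul_div_right_comm, Real.log_mul (by apply ne_of_gt; apply div_pos <;> linarith)
        (Real.exp_pos 1).ne', Real.log_exp]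
    rw [h3]
    set l := Real.log ((p : ℝ) / k)
    have h4 : 8 * ((johnsonGraph p k).maxDegree : ℝ)
        * (Real.log (Fintype.card (SparseVec p k)) + β * (3 * k * n) + 5)
        ≤ 8 * (k * p) * (k * (6 * (l + 1 + β * n))) := by
      have hb : 0 ≤ β * n := by positivity
      refine mul_le_mul (by gcongr; exact cast_maxDegree_le) ?_ ?_ (by positivity)
      · nlinarith
      · have : 0 ≤ Real.log (Fintype.card (SparseVec p k)) := Real.log_natCast_nonneg _
        positivity
    refine h4.trans ?_
    have h5 : (0 : ℝ) ≤ k ^ 2 * p * (l + 1 + β * n) := by positivity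
    nlinarith

lemma IsRegularSample.metropolis_outputs_fast (h : IsRegularSample X W S) (hk : 100 ≤ k)
    (hp : 3 * k ≤ p) (hn : 0 < n) {β : ℝ} (hβ : 8 * (k * Real.log (p / k)) ≤ β * n) :
    OutputsAfter (SRSample.metropolis (S, X, W) β) S (300 * (k ^ 2 * p)) (3 / 4) := by
  have hn' : (0 : ℝ) < n := by exact_mod_cast hn
  have hk' : (100 : ℝ) ≤ k := by exact_mod_cast hk
  have hp' : (3 : ℝ) * k ≤ p := by exact_mod_cast hp
  have h1 := one_le_log_div (p := p) (k := k) (by omega) hp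
  have hL0 : 0 ≤ k * Real.log ((p : ℝ) / k) := by positivity
  have hβ0 : 0 ≤ β := by
    by_contra hneg
    nlinarith
  have hcard := card_sparseVec_le_exp (p := p) (k := k) (by omega) hp
  have hexp := exp_neg_two_mul_le (p := p) (k := k) (by omega) hp
  have hlogp := log_le_mul_log_div (p := p) (k := k) (by omega) hp
  set L := k * Real.log ((p : ℝ) / k)
  have hsmall : 1 / (p : ℝ) ^ 2 ≤ 1 / 100 := by
    apply one_div_le_one_div_of_le (by norm_num); nlinarith
  have hRη : 3 * k * n * (1 / (p : ℝ) ^ 2) ≤ 3 / 2 * n / 100 := by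
    rw [mul_one_div, div_le_iff₀ (by nlinarith)]
    nlinarith [mul_le_mul_of_nonneg_right hp' hn'.le,
      mul_le_mul_of_nonneg_left (show (100 : ℝ) ≤ p by linarith) (mul_nonneg hn'.le
        (show (0 : ℝ) ≤ p by linarith))]
  refine metropolis_outputsAfter_of_drift h.gainAwayFrom (by positivity) h.hamiltonian_sub_le
    (by nlinarith) (johnsonGraph_maxDegree_pos (by omega) hp S) hβ0 (η := 1 / (p : ℝ) ^ 2) ?_
    hsmall hRη (δ := 1 / (p : ℝ) ^ 2) ?_ hsmall hRη ?_
  · refine le_trans ?_ hexp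
    calc _ ≤ Real.exp (2 * L) * Real.exp (-(4 * L)) :=
          mul_le_mul hcard (Real.exp_le_exp.2 (by linarith)) (Real.exp_pos _).le
            (Real.exp_pos _).le
      _ = Real.exp (-(2 * L)) := by rw [← Real.exp_add]; congr 1; ring
  · refine le_trans ?_ hexp
    have h2 : ((johnsonGraph p k).maxDegree : ℝ) ≤ Real.exp (2 * L) := by
      calc ((johnsonGraph p k).maxDegree : ℝ) ≤ k * p := cast_maxDegree_le
        _ ≤ p ^ 2 := by nlinarith
        _ = Real.exp (((2 : ℕ) : ℝ) * Real.log p) := by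
            rw [Real.exp_nat_mul, Real.exp_log (by linarith)]
        _ ≤ _ := by rw [Real.exp_le_exp]; push_cast; linarith
    calc _ ≤ Real.exp (2 * L) * Real.exp (-(4 * L)) :=
          mul_le_mul h2 (Real.exp_le_exp.2 (by linarith)) (Real.exp_pos _).le
            (Real.exp_pos _).le
      _ = Real.exp (-(2 * L)) := by rw [← Real.exp_add]; congr 1; ring
  · rw [range_div_gain hn]
    have h2 : (30 * (2 * k) + 1) * (4 * ((johnsonGraph p k).maxDegree : ℝ))
        ≤ (61 * k) * (4 * (k * p)) := by
      refine mul_le_mul (by linarith) ?_ (by positivity) (by positivity)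
      gcongr; exact cast_maxDegree_le
    have h3 : (0 : ℝ) ≤ k ^ 2 * p := by positivity
    linarith

end Outputs

/-! ### The failure probability -/

/-- With `L = k log (p / k)` and `n ≥ 18432 L`, the chi-squared tails are at most `exp (-4 L)`,
against at most `exp (2 L)` states and `p ^ 2 ≤ exp (2 L)` pairs of columns. -/
lemma prod_not_isRegularSample_le_div {p k n : ℕ} {σ : ℝ≥0} (hσ : 0 < σ) (hk : 100 ≤ k)
    (hp : 3 * k ≤ p)
    (hσ' : (σ : ℝ) ^ 2 ≤ 1 / 2 * min (Real.log p / Real.log (Real.log p)) k)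
    (hn : 18432 * (k * Real.log (p / k)) ≤ n) (S : SparseVec p k) :
    ((designLaw n p).prod (noiseLaw n σ)).real {q | ¬ IsRegularSample q.1 q.2 S} ≤ 6 / p := by
  have hk' : (100 : ℝ) ≤ k := by exact_mod_cast hk
  have hp' : (3 : ℝ) * k ≤ p := by exact_mod_cast hp
  have h1 := one_le_log_div (p := p) (k := k) (by omega) hp
  have hL0 : 0 < k * Real.log ((p : ℝ) / k) := by positivity
  have hnoise := sq_mul_log_le hk hp hσ'
  have hcard := card_sparseVec_le_exp (p := p) (k := k) (by omega) hp
  have hexp := exp_neg_two_mul_le (p := p) (k := k) (by omega) hp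
  have hlogp := log_le_mul_log_div (p := p) (k := k) (by omega) hp
  set L := k * Real.log ((p : ℝ) / k)
  have hσ0 : (0 : ℝ) < σ := by exact_mod_cast hσ
  have hp0 : (0 : ℝ) < p := by linarith
  have hn' : 0 < n := by
    have : (0 : ℝ) < n := by linarith
    exact_mod_cast this
  refine (prod_not_isRegularSample_le hσ hn' S).trans ?_
  have hsq : (p : ℝ) ^ 2 ≤ Real.exp (2 * L) := by
    calc (p : ℝ) ^ 2 = Real.exp (((2 : ℕ) : ℝ) * Real.log p) := by
          rw [Real.exp_nat_mul, Real.exp_log hp0]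
      _ ≤ _ := by rw [Real.exp_le_exp]; push_cast; linarith
  have hprod : Real.exp (2 * L) * Real.exp (-((n : ℝ) / 4608)) ≤ 1 / p ^ 2 := by
    refine le_trans ?_ hexp
    rw [← Real.exp_add, Real.exp_le_exp]; linarith
  have e1 : 2 * (Fintype.card (SparseVec p k) : ℝ) * Real.exp (-((n : ℝ) / 4608))
      ≤ 2 * (1 / p ^ 2) := by
    rw [mul_assoc]
    refine mul_le_mul_of_nonneg_left (le_trans ?_ hprod) (by norm_num)
    gcongr
  have e2 : (p : ℝ) ^ 2 * Real.exp (-((n : ℝ) / 4608)) ≤ 1 / p ^ 2 := by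
    refine le_trans ?_ hprod
    gcongr
  have e3 : Real.exp (-((n : ℝ) / 8)) ≤ 1 / p ^ 2 := by
    refine le_trans ?_ hexp
    rw [Real.exp_le_exp]; linarith
  have e4 : 2 * (p : ℝ) * Real.exp (-((n : ℝ) / (1024 * (σ : ℝ) ^ 2))) ≤ 2 * (1 / p) := by
    have h2 : 2 * Real.log p ≤ (n : ℝ) / (1024 * (σ : ℝ) ^ 2) := by
      rw [le_div_iff₀ (by positivity)]; linarith
    calc _ ≤ 2 * (p : ℝ) * Real.exp (-(((2 : ℕ) : ℝ) * Real.log p)) := by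
          gcongr; exact_mod_cast h2
      _ = 2 * (1 / p) := by
          rw [Real.exp_neg, Real.exp_nat_mul, Real.exp_log hp0]; field_simp
  have e5 : 1 / (p : ℝ) ^ 2 ≤ 1 / p := by
    apply one_div_le_one_div_of_le hp0; nlinarith
  have e6 : 6 / (p : ℝ) = 6 * (1 / p) := by ring
  rw [e6]
  linarith

theorem theorem4p2 :
    ∃ c > (0 : ℝ), ∃ C₀ > (0 : ℝ), ∃ K₁ > (0 : ℝ), ∃ K₂ > (0 : ℝ), ∃ K₃ > (0 : ℝ),
      ∀ C : ℝ, C₀ ≤ C → ∀ ε : ℝ, 0 < ε → ∃ k₀ : ℕ,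
        ∀ (k p n : ℕ) (σ : ℝ≥0), k₀ ≤ k → 3 * k ≤ p → 0 < σ →
          (σ : ℝ) ^ 2 ≤ c * min (Real.log p / Real.log (Real.log p)) k →
          C * k * Real.log (p / k) ≤ n →
          srLaw p k n σ {ω : SRSample p k n | ¬
            ((∀ β : ℝ, K₁ * (Real.log (k * p) / n) ≤ β →
                OutputsAfter (ω.metropolis β) ω.signal
                  (K₂ * (k ^ 3 * p * (Real.log (p * Real.exp 1 / k) + β * n))) (3 / 4)) ∧
              (∀ β : ℝ, 8 / C < β →
                OutputsAfter (ω.metropolis β) ω.signal (K₃ * (k ^ 2 * p)) (3 / 4)) ∧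
              OutputsAfter ω.greedy ω.signal (K₃ * (k ^ 2 * p)) (3 / 4))}
            ≤ ENNReal.ofReal ε := by
  -- The chi-squared tails at relative deviation `1 / 24` have rate `(1 / 24) ^ 2 / 8 = 1 / 4608`;
  -- `C₀ = 4 * 4608` makes them at most the inverse square of the bound on the number of states.
  refine ⟨1 / 2, by norm_num, 18432, by norm_num, 2, by norm_num, 100, by norm_num, 300,
    by norm_num, fun C hC ε hε => ⟨max 100 ⌈6 / ε⌉₊, fun k p n σ hk hp hσ hσ' hn => ?_⟩⟩
  have hk100 : 100 ≤ k := (le_max_left _ _).trans hk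
  have hkε : 6 / ε ≤ k := (Nat.le_ceil _).trans (by exact_mod_cast (le_max_right _ _).trans hk)
  have hk' : (100 : ℝ) ≤ k := by exact_mod_cast hk100
  have hp' : (3 : ℝ) * k ≤ p := by exact_mod_cast hp
  have h1 := one_le_log_div (p := p) (k := k) (by omega) hp
  have hL0 : 0 < k * Real.log ((p : ℝ) / k) := by positivity
  have hn₀ : 18432 * (k * Real.log ((p : ℝ) / k)) ≤ n := by
    refine le_trans ?_ hn
    rw [mul_assoc]
    gcongr
  have hn' : (0 : ℝ) < n := by linarith
  have hn0 : 0 < n := by exact_mod_cast hn'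
  refine (measure_mono ?_).trans (srLaw_le_of_forall (p := p) (k := k) (n := n) (σ := σ)
    (E := fun S => {q | ¬ IsRegularSample q.1 q.2 S}) (b := ENNReal.ofReal ε) fun S => ?_)
  · rintro ⟨S, X, W⟩ hω hreg
    refine hω ⟨fun β hβ => hreg.metropolis_outputs_slow hk100 hp hn0 hβ, fun β hβ => ?_,
      hreg.greedy_outputs hk100 hp hn0⟩
    refine hreg.metropolis_outputs_fast hk100 hp hn0 ?_
    have hC0 : 0 < C := by linarith
    calc 8 * (k * Real.log ((p : ℝ) / k)) = 8 / C * (C * k * Real.log ((p : ℝ) / k)) := by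
          field_simp
      _ ≤ β * n := mul_le_mul hβ.le hn (by positivity) (le_trans (by positivity) hβ.le)
  · rw [← ENNReal.ofReal_toReal (measure_ne_top ((designLaw n p).prod (noiseLaw n σ)) _)]
    refine ENNReal.ofReal_le_ofReal
      ((prod_not_isRegularSample_le_div hσ hk100 hp hσ' hn₀ S).trans ?_)
    rw [div_le_iff₀ (by linarith), mul_comm]
    rw [div_le_iff₀ hε] at hkε
    nlinarith
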